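/- A martingale is a function $f$ from finite bitstrings to non-negative reals such that $f(x) = (f(x0)+f(x1))/2$ for all $x$. A sequence $\beta \in \{0,1\}^{\mathbb N}$ is computably random (CR), respectively CR relative to $\alpha \in \{0,1\}^{\mathbb N}$, if every computable martingale, respectively every martingale computable with oracle $\alpha$, is bounded on the prefixes of $\beta$. (A real-valued function on strings is computable if approximations of it to any given precision can be computed.) A martingale $f$ is uniformly $\alpha$-computable if there is an oracle machine that computes $f$ with oracle $\alpha$ and that halts on every input with every sequence as oracle; $\beta$ is uniformly CR relative to $\alpha$ if every uniformly $\alpha$-computable martingale is bounded on the prefixes of $\beta$. Theorem. There exists a binary sequence that is not CR, whose odd bits form a CR sequence, and whose even bits are CR relative to its odd bits. Consequently, writing $\alpha\oplus\beta = \alpha_1\beta_1\alpha_2\beta_2\dots$, neither of the following implications holds for all sequences $\alpha$ and $\beta$: (i) if $\alpha$ is CR and $\beta$ is CR relative to $\alpha$, then $\alpha\oplus\beta$ is CR; (ii) if $\alpha$ is CR and $\beta$ is uniformly CR relative to $\alpha$, then $\alpha\oplus\beta$ is CR. -/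

import Mathlib

open scoped NNReal

namespace VanLambalgen

/-- A martingale: a function from bitstrings to non-negative reals such that
`f x = (f (x0) + f (x1)) / 2` for all strings `x`. -/
def IsMartingale (f : List Bool → ℝ≥0) : Prop :=
  ∀ x : List Bool, f x = (f (x ++ [false]) + f (x ++ [true])) / 2

/-- The dyadic rationals `a x n / 2 ^ n` approximate `f x` with error at most `2 ^ (-n)`. -/
def Approximates (a : List Bool → ℕ → ℕ) (f : List Bool → ℝ≥0) : Prop :=
  ∀ (x : List Bool) (n : ℕ), |(f x : ℝ) - (a x n : ℝ) / 2 ^ n| ≤ 1 / 2 ^ n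

/-- A bit sequence as an oracle: query `n` is answered by the `n`-th bit, read as `0` or `1`. -/
def bitOracle (α : ℕ → Bool) : ℕ →. ℕ := fun n => Part.some (α n).toNat

/-- A (non-negative) real-valued function on bitstrings is computable if there is an algorithm
that, given a string and a precision, returns a rational approximation within that precision. -/
def RealComputable (f : List Bool → ℝ≥0) : Prop :=
  ∃ a : List Bool → ℕ → ℕ, Computable₂ a ∧ Approximates a f

/-- As `RealComputable`, for algorithms with access to the oracle `α`. -/
def RealComputableRel (α : ℕ → Bool) (f : List Bool → ℝ≥0) : Prop :=
  ∃ a : List Bool → ℕ → ℕ, ComputableIn₂ {bitOracle α} a ∧ Approximates a f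

/-- The initial segment of length `n` of the sequence `α`. -/
def initSeg (α : ℕ → Bool) (n : ℕ) : List Bool := (List.range n).map α

/-- The set of values of `f` on all prefixes of `α` is bounded. -/
def BoundedOn (f : List Bool → ℝ≥0) (α : ℕ → Bool) : Prop :=
  BddAbove (Set.range fun n : ℕ => f (initSeg α n))

/-- `α` is computably random (CR). -/
def CR (α : ℕ → Bool) : Prop :=
  ∀ f : List Bool → ℝ≥0, IsMartingale f → RealComputable f → BoundedOn f α

/-- `CRRel α β`: the sequence `β` is computably random relative to `α`. -/
def CRRel (α β : ℕ → Bool) : Prop :=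
  ∀ f : List Bool → ℝ≥0, IsMartingale f → RealComputableRel α f → BoundedOn f β

/-- Programs with access to an oracle: the oracle is a parameter of the evaluation, so that one
and the same program can be run with different oracles. -/
inductive OracleCode : Type
  | zero : OracleCode
  | succ : OracleCode
  | left : OracleCode
  | right : OracleCode
  | oracle : OracleCode
  | pair : OracleCode → OracleCode → OracleCode
  | comp : OracleCode → OracleCode → OracleCode
  | prec : OracleCode → OracleCode → OracleCode
  | rfind : OracleCode → OracleCode

/-- The partial function computed by a program with oracle `O`; the clauses are those of
`Nat.RecursiveIn {O}`. -/
def OracleCode.eval (O : ℕ →. ℕ) : OracleCode → (ℕ →. ℕ)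
  | .zero => fun _ => Part.some 0
  | .succ => fun n => Part.some (n + 1)
  | .left => fun n => Part.some (Nat.unpair n).1
  | .right => fun n => Part.some (Nat.unpair n).2
  | .oracle => O
  | .pair c d => fun n => Nat.pair <$> c.eval O n <*> d.eval O n
  | .comp c d => fun n => d.eval O n >>= c.eval O
  | .prec c d => fun p =>
      Nat.rec (c.eval O (Nat.unpair p).1)
        (fun y IH => IH >>= fun i => d.eval O (Nat.pair (Nat.unpair p).1 (Nat.pair y i)))
        (Nat.unpair p).2
  | .rfind c => fun p => Nat.rfind fun n => (fun m => decide (m = 0)) <$> c.eval O (Nat.pair p n)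

/-- `f` is uniformly `α`-computable: some oracle program computes `f` with oracle `α`, and is total
with every sequence as oracle. -/
def RealComputableUnif (α : ℕ → Bool) (f : List Bool → ℝ≥0) : Prop :=
  ∃ c : OracleCode,
    (∀ (γ : ℕ → Bool) (k : ℕ), (c.eval (bitOracle γ) k).Dom) ∧
    ∃ a : List Bool → ℕ → ℕ,
      (∀ (x : List Bool) (n : ℕ),
        c.eval (bitOracle α) (Encodable.encode (x, n)) = Part.some (a x n)) ∧
      Approximates a f

/-- `CRUnif α β`: the sequence `β` is uniformly computably random relative to `α`. -/
def CRUnif (α β : ℕ → Bool) : Prop :=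
  ∀ f : List Bool → ℝ≥0, IsMartingale f → RealComputableUnif α f → BoundedOn f β

/-- The bits of `ω` at the odd positions 1, 3, 5, … (a sequence is written `ω₁ω₂ω₃…`, and `ω n`
is its bit at position `n + 1`). -/
def oddBits (ω : ℕ → Bool) : ℕ → Bool := fun n => ω (2 * n)

/-- The bits of `ω` at the even positions 2, 4, 6, … -/
def evenBits (ω : ℕ → Bool) : ℕ → Bool := fun n => ω (2 * n + 1)

/-- The sequence `α₁β₁α₂β₂…`. -/
def join (α β : ℕ → Bool) : ℕ → Bool :=
  fun n => if n % 2 = 0 then α (n / 2) else β (n / 2)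

end VanLambalgen

namespace VanLambalgen

/-! The first sequence α is computably random but weak as an oracle: no function computable from α
bounds the halting times of almost all halting programs (`exists_random_of_weak_oracle`). The second
sequence β is random relative to α, yet for infinitely many programs L, with halting time s and q =
pair L s, its bits at L, …, 2L-1 repeat those of α at q², …, q²+L-1 (`exists_random_with_blocks`).

A computable martingale exploits these copies on α ⊕ β (`not_CR_join`). At position k of α it
decodes L and s from q = sqrt k, checks the halting time, and predicts the bit from one of β that
has already been read. The capital 2^(-L-1) reserved for L grows to 1/2 on a copied block, and
infinitely many L make the total unbounded.

Copying does not spoil the randomness of β relative to α (`exists_extension_with_block`). Let d be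
an α-computable supermartingale that is below C along γ, and suppose that appending the block of any
late L to any extension of γ of length L drives d up to C. Then a computable gambler wins on α
itself: on reaching q², if the first q bits of α already determine d on strings of length at most
2L, the gambler extends γ to length L without increasing d and plays d on the block that follows.
Each such round wins at least C minus the value of d at γ. As α is weak, the part of α needed to
compute d is infinitely often shorter than s ≤ q, so there are infinitely many rounds, against the
randomness of α.

Both sequences come from one forcing construction (`exists_generic`), whose conditions are strings
with a bound on a supermartingale along them. -/

@[simp] lemma length_initSeg (α : ℕ → Bool) (n : ℕ) : (initSeg α n).length = n := by
  simp [initSeg]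

@[simp] lemma initSeg_zero (α : ℕ → Bool) : initSeg α 0 = [] := rfl

lemma initSeg_succ (α : ℕ → Bool) (n : ℕ) : initSeg α (n + 1) = initSeg α n ++ [α n] := by
  simp [initSeg, List.range_succ]

lemma getElem?_initSeg (α : ℕ → Bool) (n k : ℕ) :
    (initSeg α n)[k]? = if k < n then some (α k) else none := by
  split_ifs with h <;> simp [initSeg, h]

lemma take_initSeg (α : ℕ → Bool) (m n : ℕ) :
    (initSeg α n).take m = initSeg α (min m n) := by
  simp [initSeg, ← List.map_take, List.take_range]

lemma initSeg_prefix (α : ℕ → Bool) {m n : ℕ} (h : m ≤ n) : initSeg α m <+: initSeg α n := by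
  rw [← Nat.min_eq_left h, ← take_initSeg]
  exact List.take_prefix _ _

/-! ### Integer-valued supermartingales -/

/-- A function `d` such that `d x / 2 ^ |x|` is a supermartingale. -/
def IsIntSupermartingale (d : List Bool → ℕ) : Prop :=
  ∀ x, d (x ++ [false]) + d (x ++ [true]) ≤ 4 * d x

/-- `d x / 2 ^ |x|` is bounded on the prefixes of `α`. -/
def IntBoundedOn (d : List Bool → ℕ) (α : ℕ → Bool) : Prop :=
  ∃ C : ℕ, ∀ n, d (initSeg α n) < C * 2 ^ n

/-- The rounding up of a martingale to an integer-valued supermartingale. -/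
def roundUp (a : List Bool → ℕ → ℕ) (x : List Bool) : ℕ := a x x.length + 4

lemma Approximates.abs_sub_le {a : List Bool → ℕ → ℕ} {f : List Bool → ℝ≥0}
    (h : Approximates a f) (x : List Bool) (n : ℕ) :
    |(f x : ℝ) * 2 ^ n - a x n| ≤ 1 := by
  have h1 := h x n
  have h2 : (0 : ℝ) < 2 ^ n := by positivity
  have : (f x : ℝ) * 2 ^ n - a x n = (f x - a x n / 2 ^ n) * 2 ^ n := by field_simp
  rw [this, abs_mul, abs_of_pos h2]
  calc _ ≤ 1 / 2 ^ n * (2 : ℝ) ^ n := by gcongr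
    _ = 1 := by field_simp

/-- Each approximation is off by at most 1 in units of 2^(-|x|), so the two children together exceed
four times the parent by at most 6. Adding c everywhere repairs this when 2c + 6 ≤ 4c, which holds
for c = 4. -/
lemma Approximates.isIntSupermartingale {a : List Bool → ℕ → ℕ} {f : List Bool → ℝ≥0}
    (h : Approximates a f) (hf : IsMartingale f) : IsIntSupermartingale (roundUp a) := by
  intro x
  have h0 := abs_le.1 (h.abs_sub_le (x ++ [false]) (x.length + 1))
  have h1 := abs_le.1 (h.abs_sub_le (x ++ [true]) (x.length + 1))
  have h2 := abs_le.1 (h.abs_sub_le x x.length)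
  have h3 : (f x : ℝ) = (f (x ++ [false]) + f (x ++ [true])) / 2 := by
    exact_mod_cast congrArg NNReal.toReal (hf x)
  simp only [roundUp, List.length_append, List.length_singleton]
  have h4 : (f (x ++ [false]) : ℝ) * 2 ^ (x.length + 1) + f (x ++ [true]) * 2 ^ (x.length + 1) =
      4 * (f x * 2 ^ x.length) := by rw [h3, pow_succ]; ring
  have : (a (x ++ [false]) (x.length + 1) + 4 + (a (x ++ [true]) (x.length + 1) + 4) : ℝ) ≤
      4 * (a x x.length + 4) := by linarith [h0.1, h1.1, h2.2]
  exact_mod_cast this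

lemma Approximates.boundedOn {a : List Bool → ℕ → ℕ} {f : List Bool → ℝ≥0}
    (h : Approximates a f) {β : ℕ → Bool} (hb : IntBoundedOn (roundUp a) β) : BoundedOn f β := by
  obtain ⟨C, hC⟩ := hb
  refine ⟨C, ?_⟩
  rintro _ ⟨n, rfl⟩
  have h0 := abs_le.1 (h.abs_sub_le (initSeg β n) n)
  have h1 := hC n
  rw [roundUp, length_initSeg] at h1
  have h2 : (a (initSeg β n) n + 4 : ℝ) < C * 2 ^ n := by exact_mod_cast h1
  have h3 : (f (initSeg β n) : ℝ) * 2 ^ n ≤ C * 2 ^ n := by linarith [h0.2]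
  have h4 : (0 : ℝ) < 2 ^ n := by positivity
  exact_mod_cast le_of_mul_le_mul_right h3 h4

lemma computable_roundUp {a : List Bool → ℕ → ℕ} (ha : Computable₂ a) :
    Computable (roundUp a) :=
  (Primrec.nat_add.comp .id (.const 4)).to_comp.comp (ha.comp .id .list_length)

/-! ### The use principle -/

/-- `e` computes the partial function `f` from the initial segments of the oracle `α`. -/
structure Simulates (α : ℕ → Bool) (e : List Bool → ℕ → Option ℕ) (f : ℕ →. ℕ) : Prop where
  primrec : Primrec₂ e
  mono : ∀ {m n k v}, m ≤ n → e (initSeg α m) k = some v → e (initSeg α n) k = some v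
  mem_iff : ∀ k v, v ∈ f k ↔ ∃ n, e (initSeg α n) k = some v

lemma Simulates.of_primrec (α : ℕ → Bool) {g : ℕ → ℕ} (hg : Primrec g) {f : ℕ →. ℕ}
    (h : ∀ n, f n = Part.some (g n)) : Simulates α (fun _ k => some (g k)) f where
  primrec := (Primrec.option_some.comp (hg.comp .snd)).to₂
  mono _ h := h
  mem_iff k v := by simp [h, eq_comm]

lemma Simulates.oracle (α : ℕ → Bool) :
    Simulates α (fun ρ k => ρ[k]?.map Bool.toNat) (bitOracle α) where
  primrec := (Primrec.option_map₁ (.dom_bool _)).comp₂ Primrec.list_getElem?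
  mono {m n k v} hmn h := by
    simp only [getElem?_initSeg] at h ⊢
    split_ifs at h with hk
    · rw [if_pos (hk.trans_le hmn)]; exact h
    · simp at h
  mem_iff k v := by
    simp only [bitOracle, Part.mem_some_iff, getElem?_initSeg]
    refine ⟨fun h => ⟨k + 1, by simp [h]⟩, ?_⟩
    rintro ⟨n, hn⟩
    split_ifs at hn
    · simpa [eq_comm] using hn
    · simp at hn

lemma Simulates.pair {α : ℕ → Bool} {e₁ e₂ : List Bool → ℕ → Option ℕ} {f₁ f₂ : ℕ →. ℕ}
    (h₁ : Simulates α e₁ f₁) (h₂ : Simulates α e₂ f₂) :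
    Simulates α (fun ρ k => (e₁ ρ k).bind fun u => (e₂ ρ k).map (Nat.pair u))
      (fun n => Nat.pair <$> f₁ n <*> f₂ n) where
  primrec := Primrec.option_bind h₁.primrec
    (Primrec.option_map (h₂.primrec.comp (Primrec.fst.comp .fst) (Primrec.snd.comp .fst))
      (Primrec₂.natPair.comp (Primrec.snd.comp .fst) .snd).to₂).to₂
  mono {m n k v} hmn h := by
    simp only [Option.bind_eq_some_iff, Option.map_eq_some_iff] at h ⊢
    obtain ⟨u, hu, w, hw, rfl⟩ := h
    exact ⟨u, h₁.mono hmn hu, w, h₂.mono hmn hw, rfl⟩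
  mem_iff k v := by
    simp only [Option.bind_eq_some_iff, Option.map_eq_some_iff, Seq.seq, Part.map_eq_map,
      Part.mem_bind_iff, Part.mem_map_iff, h₁.mem_iff, h₂.mem_iff]
    constructor
    · rintro ⟨_, ⟨u, ⟨m, hm⟩, rfl⟩, w, ⟨n, hn⟩, rfl⟩
      exact ⟨max m n, u, h₁.mono (le_max_left _ _) hm, w, h₂.mono (le_max_right _ _) hn, rfl⟩
    · rintro ⟨n, u, hu, w, hw, rfl⟩
      exact ⟨_, ⟨u, ⟨n, hu⟩, rfl⟩, w, ⟨n, hw⟩, rfl⟩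

lemma Simulates.comp {α : ℕ → Bool} {e₁ e₂ : List Bool → ℕ → Option ℕ} {f₁ f₂ : ℕ →. ℕ}
    (h₁ : Simulates α e₁ f₁) (h₂ : Simulates α e₂ f₂) :
    Simulates α (fun ρ k => (e₂ ρ k).bind (e₁ ρ)) (fun n => f₂ n >>= f₁) where
  primrec := Primrec.option_bind h₂.primrec (h₁.primrec.comp (Primrec.fst.comp .fst) .snd)
  mono {m n k v} hmn h := by
    simp only [Option.bind_eq_some_iff] at h ⊢
    obtain ⟨u, hu, hv⟩ := h
    exact ⟨u, h₂.mono hmn hu, h₁.mono hmn hv⟩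
  mem_iff k v := by
    refine Part.mem_bind_iff.trans ?_
    simp only [Option.bind_eq_some_iff, h₁.mem_iff, h₂.mem_iff]
    constructor
    · rintro ⟨u, ⟨m, hm⟩, n, hn⟩
      exact ⟨max m n, u, h₂.mono (le_max_left _ _) hm, h₁.mono (le_max_right _ _) hn⟩
    · rintro ⟨n, u, hu, hv⟩
      exact ⟨u, ⟨n, hu⟩, n, hv⟩

lemma Simulates.prec {α : ℕ → Bool} {e₁ e₂ : List Bool → ℕ → Option ℕ} {f₁ f₂ : ℕ →. ℕ}
    (h₁ : Simulates α e₁ f₁) (h₂ : Simulates α e₂ f₂) :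
    Simulates α
      (fun ρ k => Nat.rec (e₁ ρ k.unpair.1)
        (fun y ih => ih.bind fun i => e₂ ρ (Nat.pair k.unpair.1 (Nat.pair y i))) k.unpair.2)
      (fun p => Nat.rec (f₁ p.unpair.1)
        (fun y ih => ih >>= fun i => f₂ (Nat.pair p.unpair.1 (Nat.pair y i))) p.unpair.2) where
  primrec := by
    refine Primrec.nat_rec' (Primrec.snd.comp (Primrec.unpair.comp .snd))
      (h₁.primrec.comp .fst (Primrec.fst.comp (Primrec.unpair.comp .snd)))
      (h := fun p q => q.2.bind fun i =>
        e₂ p.1 (Nat.pair p.2.unpair.1 (Nat.pair q.1 i))) ?_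
    refine Primrec.option_bind (Primrec.snd.comp .snd) (h₂.primrec.comp ?_ ?_)
    · exact Primrec.fst.comp (Primrec.fst.comp .fst)
    · exact Primrec₂.natPair.comp
        (Primrec.fst.comp (Primrec.unpair.comp (Primrec.snd.comp (Primrec.fst.comp .fst))))
        (Primrec₂.natPair.comp (Primrec.fst.comp (Primrec.snd.comp .fst)) .snd)
  mono {m n k v} hmn := by
    generalize k.unpair.1 = a, k.unpair.2 = b
    induction b generalizing v with
    | zero => exact h₁.mono hmn
    | succ b ih =>
      intro h
      simp only [Option.bind_eq_some_iff] at h ⊢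
      obtain ⟨u, hu, hv⟩ := h
      exact ⟨u, ih hu, h₂.mono hmn hv⟩
  mem_iff k v := by
    have mono : ∀ {m n a b v}, m ≤ n →
        (Nat.rec (e₁ (initSeg α m) a)
          (fun y ih => ih.bind fun i => e₂ (initSeg α m) (Nat.pair a (Nat.pair y i))) b :
            Option ℕ) = some v →
        (Nat.rec (e₁ (initSeg α n) a)
          (fun y ih => ih.bind fun i => e₂ (initSeg α n) (Nat.pair a (Nat.pair y i))) b :
            Option ℕ) = some v := by
      intro m n a b v hmn
      induction b generalizing v with
      | zero => exact h₁.mono hmn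
      | succ b ih =>
        intro h
        simp only [Option.bind_eq_some_iff] at h ⊢
        obtain ⟨u, hu, hv⟩ := h
        exact ⟨u, ih hu, h₂.mono hmn hv⟩
    generalize k.unpair.1 = a, k.unpair.2 = b
    induction b generalizing v with
    | zero => exact h₁.mem_iff a v
    | succ b ih =>
      simp only [Option.bind_eq_some_iff, Part.bind_eq_bind, Part.mem_bind_iff, h₂.mem_iff] at ih ⊢
      constructor
      · rintro ⟨u, hu, n, hn⟩
        obtain ⟨m, hm⟩ := (ih u).1 hu
        exact ⟨max m n, u, mono (le_max_left _ _) hm, h₂.mono (le_max_right _ _) hn⟩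
      · rintro ⟨n, u, hu, hv⟩
        exact ⟨u, (ih u).2 ⟨n, hu⟩, n, hv⟩

/-- Search for a zero of `g`, giving up at an undefined value or when `b` is reached. -/
def boundedSearch (g : ℕ → Option ℕ) (b : ℕ) : Option ℕ :=
  let n := (List.range b).findIdx fun n => (g n).getD 0 == 0
  if g n = some 0 then some n else none

lemma boundedSearch_eq_some {g : ℕ → Option ℕ} {b v : ℕ} :
    boundedSearch g b = some v ↔
      v ≤ b ∧ g v = some 0 ∧ ∀ n < v, ∃ u, g n = some (u + 1) := by
  have key : ∀ n, ((g n).getD 0 == 0) = false ↔ ∃ u, g n = some (u + 1) := by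
    intro n
    rcases h : g n with _ | _ | u <;> simp
  have hlt : ∀ n < (List.range b).findIdx fun n => (g n).getD 0 == 0,
      ∃ u, g n = some (u + 1) := by
    intro n hn
    have := List.not_of_lt_findIdx hn
    rw [List.getElem_range] at this
    exact (key n).1 this
  have hle : ((List.range b).findIdx fun n => (g n).getD 0 == 0) ≤ b := by
    simpa using List.findIdx_le_length (xs := List.range b) (p := fun n => (g n).getD 0 == 0)
  simp only [boundedSearch]
  constructor
  · intro h
    split_ifs at h with h0
    obtain rfl := Option.some.inj h
    exact ⟨hle, h0, hlt⟩
  · rintro ⟨hv, h0, h1⟩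
    have : ((List.range b).findIdx fun n => (g n).getD 0 == 0) = v := by
      rcases lt_trichotomy ((List.range b).findIdx fun n => (g n).getD 0 == 0) v with hl | hl | hl
      · have hb : ((List.range b).findIdx fun n => (g n).getD 0 == 0) < (List.range b).length := by
          simpa using hl.trans_le hv
        have h2 := List.findIdx_getElem (w := hb)
        rw [List.getElem_range] at h2
        have h3 := (key _).2 (h1 _ hl)
        rw [h2] at h3
        simp at h3
      · exact hl
      · obtain ⟨u, hu⟩ := hlt v hl
        rw [h0] at hu
        simp at hu
    rw [this, if_pos h0]

/-- The length of the partial oracle doubles as a search bound. This keeps the simulation primitive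
recursive, and longer initial segments recover the unbounded search. -/
lemma Simulates.rfind {α : ℕ → Bool} {e : List Bool → ℕ → Option ℕ} {f : ℕ →. ℕ}
    (h : Simulates α e f) :
    Simulates α (fun ρ k => boundedSearch (fun n => e ρ (Nat.pair k n)) ρ.length)
      (fun p => Nat.rfind fun n => (fun m => decide (m = 0)) <$> f (Nat.pair p n)) where
  primrec := by
    have h1 : Primrec fun p : List Bool × ℕ => (List.range p.1.length).findIdx
        fun n => (e p.1 (Nat.pair p.2 n)).getD 0 == 0 := by
      refine Primrec.list_findIdx (Primrec.list_range.comp (Primrec.list_length.comp .fst)) ?_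
      exact Primrec.beq.comp (Primrec.option_getD.comp
        (h.primrec.comp (Primrec.fst.comp .fst)
          (Primrec₂.natPair.comp (Primrec.snd.comp .fst) .snd)) (.const 0)) (.const 0)
    refine Primrec.ite ?_ (Primrec.option_some.comp h1) (.const none)
    exact Primrec.eq.comp (h.primrec.comp .fst (Primrec₂.natPair.comp .snd h1)) (.const _)
  mono {m n k v} hmn := by
    simp only [boundedSearch_eq_some, length_initSeg]
    rintro ⟨h1, h2, h3⟩
    exact ⟨h1.trans hmn, h.mono hmn h2, fun i hi => (h3 i hi).imp fun u hu => h.mono hmn hu⟩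
  mem_iff k v := by
    refine Nat.mem_rfind.trans ?_
    simp only [boundedSearch_eq_some, length_initSeg, Part.map_eq_map, Part.mem_map_iff,
      h.mem_iff]
    constructor
    · rintro ⟨⟨a, ⟨n, hn⟩, ha⟩, h2⟩
      have ha : a = 0 := by simpa using ha
      subst ha
      have h3 : ∀ i < v, ∃ N u, e (initSeg α N) (Nat.pair k i) = some (u + 1) := by
        intro i hi
        obtain ⟨b, ⟨N, hN⟩, hb⟩ := h2 hi
        obtain ⟨u, rfl⟩ := Nat.exists_eq_succ_of_ne_zero (by simpa using hb)
        exact ⟨N, u, hN⟩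
      choose! N u hN using h3
      let B := (Finset.range v).sup N
      -- The stage must see the zero at `v` and all earlier nonzero values, and be long enough for
      -- the bounded search to reach `v`.
      refine ⟨max (max n B) v, le_max_right _ _, h.mono (by simp) hn, fun i hi => ⟨u i, ?_⟩⟩
      refine h.mono ?_ (hN i hi)
      have : N i ≤ B := Finset.le_sup (f := N) (Finset.mem_range.2 hi)
      omega
    · rintro ⟨n, -, h2, h3⟩
      refine ⟨⟨0, ⟨n, h2⟩, by simp⟩, fun {i} hi => ?_⟩
      obtain ⟨u, hu⟩ := h3 i hi
      exact ⟨u + 1, ⟨n, hu⟩, by simp⟩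

/-- The use principle: a computation with oracle `α` depends on a finite part of `α`. -/
theorem exists_simulates {α : ℕ → Bool} {f : ℕ →. ℕ} (hf : Nat.RecursiveIn {bitOracle α} f) :
    ∃ e, Simulates α e f := by
  induction hf with
  | zero => exact ⟨_, .of_primrec α (.const 0) fun _ => rfl⟩
  | succ => exact ⟨_, .of_primrec α .succ fun _ => rfl⟩
  | left => exact ⟨_, .of_primrec α (Primrec.fst.comp .unpair) fun _ => rfl⟩
  | right => exact ⟨_, .of_primrec α (Primrec.snd.comp .unpair) fun _ => rfl⟩
  | oracle g hg =>
    obtain rfl : g = bitOracle α := hg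
    exact ⟨_, .oracle α⟩
  | pair _ _ h₁ h₂ =>
    obtain ⟨e₁, h₁⟩ := h₁
    obtain ⟨e₂, h₂⟩ := h₂
    exact ⟨_, h₁.pair h₂⟩
  | comp _ _ h₁ h₂ =>
    obtain ⟨e₁, h₁⟩ := h₁
    obtain ⟨e₂, h₂⟩ := h₂
    exact ⟨_, h₁.comp h₂⟩
  | prec _ _ h₁ h₂ =>
    obtain ⟨e₁, h₁⟩ := h₁
    obtain ⟨e₂, h₂⟩ := h₂
    exact ⟨_, h₁.prec h₂⟩
  | rfind _ h =>
    obtain ⟨e, h⟩ := h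
    exact ⟨_, h.rfind⟩

/-- `e` computes the total function `d` from the initial segments of the oracle `α`. -/
structure Computes (α : ℕ → Bool) (e : List Bool → List Bool → Option ℕ)
    (d : List Bool → ℕ) : Prop where
  primrec : Primrec₂ e
  mono : ∀ {m n x v}, m ≤ n → e (initSeg α m) x = some v → e (initSeg α n) x = some v
  sound : ∀ {n x v}, e (initSeg α n) x = some v → v = d x
  complete : ∀ x, ∃ n, e (initSeg α n) x = some (d x)

lemma exists_computes_roundUp {α : ℕ → Bool} {a : List Bool → ℕ → ℕ}
    (ha : ComputableIn₂ {bitOracle α} a) : ∃ e, Computes α e (roundUp a) := by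
  obtain ⟨e, he⟩ := exists_simulates ha
  have key : ∀ x : List Bool, ∀ v, v = a x x.length ↔
      ∃ n, e (initSeg α n) (Encodable.encode (x, x.length)) = some v := by
    intro x v
    rw [← he.mem_iff]
    simp
  refine ⟨fun ρ x => (e ρ (Encodable.encode (x, x.length))).map (· + 4), ?_, ?_, ?_, ?_⟩
  · refine Primrec.option_map (he.primrec.comp .fst (Primrec.encode.comp
      (Primrec.pair .snd (Primrec.list_length.comp .snd)))) ?_
    exact (Primrec.nat_add.comp .snd (.const 4)).to₂
  · intro m n x v hmn h
    simp only [Option.map_eq_some_iff] at h ⊢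
    obtain ⟨u, hu, rfl⟩ := h
    exact ⟨u, he.mono hmn hu, rfl⟩
  · intro n x v h
    simp only [Option.map_eq_some_iff] at h
    obtain ⟨u, hu, rfl⟩ := h
    rw [roundUp, ← (key x u).2 ⟨n, hu⟩]
  · intro x
    obtain ⟨n, hn⟩ := (key x _).1 rfl
    exact ⟨n, by rw [hn]; rfl⟩

/-! ### Countability, and forcing with supermartingale bounds -/

theorem countable_computable (α σ : Type*) [Primcodable α] [Primcodable σ] :
    {f : α → σ | Computable f}.Countable := by
  have h : ∀ f : {f : α → σ | Computable f}, ∃ c : Nat.Partrec.Code,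
      c.eval = fun n => Part.bind (Encodable.decode (α := α) n) fun a =>
        (Part.some (f.1 a)).map Encodable.encode :=
    fun f => Nat.Partrec.Code.exists_code.1 f.2
  choose c hc using h
  refine (Function.Injective.countable (f := c) fun f g hfg => Subtype.ext (funext fun a => ?_)).to_set
  have h1 := congrFun ((hc f).symm.trans ((congrArg _ hfg).trans (hc g))) (Encodable.encode a)
  simpa using h1

/-- The martingale value `d / 2 ^ |·|` stays below `C` on all prefixes of `σ`. -/
def Safe (d : List Bool → ℕ) (C : ℕ) (σ : List Bool) : Prop :=
  ∀ τ, τ <+: σ → d τ < C * 2 ^ τ.length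

lemma Safe.of_prefix {d : List Bool → ℕ} {C : ℕ} {σ τ : List Bool} (h : Safe d C σ)
    (hτ : τ <+: σ) : Safe d C τ := fun _ hρ => h _ (hρ.trans hτ)

lemma Safe.concat {d : List Bool → ℕ} {C : ℕ} {σ : List Bool} (h : Safe d C σ) {b : Bool}
    (hb : d (σ ++ [b]) < C * 2 ^ (σ.length + 1)) : Safe d C (σ ++ [b]) := by
  intro τ hτ
  rcases List.prefix_concat_iff.1 hτ with rfl | hτ
  · simpa using hb
  · exact h _ hτ

/-- If both children reached the bound, their sum would be at least 4C · 2^|σ|, more than four times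
the value at σ. -/
lemma Safe.exists_concat {d : List Bool → ℕ} (hd : IsIntSupermartingale d) {C : ℕ}
    {σ : List Bool} (h : Safe d C σ) : ∃ b, Safe d C (σ ++ [b]) := by
  by_contra! hc
  have h0 := hd σ
  have h1 := h σ (List.prefix_refl σ)
  have h2 := fun b => mt h.concat (hc b)
  have h3 := h2 false
  have h4 := h2 true
  rw [pow_succ] at h3 h4
  linarith

lemma Safe.exists_extension {d : List Bool → ℕ} (hd : IsIntSupermartingale d) {C : ℕ}
    {σ : List Bool} (h : Safe d C σ) (n : ℕ) :
    ∃ σ', σ <+: σ' ∧ Safe d C σ' ∧ n ≤ σ'.length := by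
  induction n with
  | zero => exact ⟨σ, List.prefix_refl σ, h, zero_le⟩
  | succ n ih =>
    obtain ⟨σ', h1, h2, h3⟩ := ih
    obtain ⟨b, hb⟩ := h2.exists_concat hd
    exact ⟨_, h1.trans (List.prefix_append _ _), hb, by simpa using h3⟩

/-- A forcing condition: a string on which a capital function from `D` stays below a bound. -/
structure Condition (D : Set (List Bool → ℕ)) where
  str : List Bool
  cap : List Bool → ℕ
  bound : ℕ
  cap_mem : cap ∈ D
  safe : Safe cap bound str

/-- Larger conditions are stronger: the string is longer, and the new bound implies the old one at
every string, so a bound once promised holds for good. -/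
instance (D : Set (List Bool → ℕ)) : Preorder (Condition D) where
  le p q := p.str <+: q.str ∧
    ∀ x, q.cap x < q.bound * 2 ^ x.length → p.cap x < p.bound * 2 ^ x.length
  le_refl p := ⟨List.prefix_refl _, fun _ h => h⟩
  le_trans p q r hpq hqr := ⟨hpq.1.trans hqr.1, fun x h => hpq.2 x (hqr.2 x h)⟩

/-- A sequence on which all supermartingales of a countable class are bounded, and which meets
countably many further requirements. -/
theorem exists_generic {D : Set (List Bool → ℕ)} (hD : D.Countable) (hne : D.Nonempty)
    (hsm : ∀ d ∈ D, IsIntSupermartingale d)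
    (hadd : ∀ d ∈ D, ∀ d' ∈ D, ∀ K : ℕ, (fun x => K * d x + d' x) ∈ D)
    {ι : Type*} [Countable ι] (R : ι → List Bool → (List Bool → Prop) → Prop)
    (hR : ∀ j, ∀ d ∈ D, ∀ C σ, Safe d C σ →
      ∃ σ', σ <+: σ' ∧ Safe d C σ' ∧ R j σ' (Safe d C)) :
    ∃ α : ℕ → Bool, (∀ d ∈ D, IntBoundedOn d α) ∧
      ∀ j, ∃ (n : ℕ) (S : List Bool → Prop), R j (initSeg α n) S ∧ ∀ m, S (initSeg α m) := by
  classical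
  obtain ⟨d₀, hd₀⟩ := hne
  have : Countable D := hD.to_subtype
  have : Encodable (ι ⊕ ℕ ⊕ D) := Encodable.ofCountable _
  let p₀ : Condition D := ⟨[], d₀, d₀ [] + 1, hd₀, fun τ hτ => by
    obtain rfl := List.prefix_nil.1 hτ
    simp⟩
  have cof_req : ∀ j, IsCofinal {p : Condition D | R j p.str (Safe p.cap p.bound)} := by
    intro j p
    obtain ⟨σ', h1, h2, h3⟩ := hR j p.cap p.cap_mem p.bound p.str p.safe
    exact ⟨⟨σ', p.cap, p.bound, p.cap_mem, h2⟩, h3, h1, fun _ h => h⟩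
  have cof_len : ∀ n, IsCofinal {p : Condition D | n ≤ p.str.length} := by
    intro n p
    obtain ⟨σ', h1, h2, h3⟩ := p.safe.exists_extension (hsm _ p.cap_mem) n
    exact ⟨⟨σ', p.cap, p.bound, p.cap_mem, h2⟩, h3, h1, fun _ h => h⟩
  have cof_cap : ∀ d : D, IsCofinal {p : Condition D |
      ∃ C, ∀ x, p.cap x < p.bound * 2 ^ x.length → d.1 x < C * 2 ^ x.length} := by
    rintro ⟨d, hd⟩ p
    -- `K` exceeds every value of `d` along the current string. Since `p.cap` is an integer strictly
    -- below its bound there, K · `p.cap` + `d` stays below K times that bound.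
    let K := ∑ i ∈ Finset.range (p.str.length + 1), d (p.str.take i) + 1
    have hK : ∀ τ, τ <+: p.str → d τ < K := by
      intro τ hτ
      have h1 : p.str.take τ.length = τ := (List.prefix_iff_eq_take.1 hτ).symm
      have h2 := Finset.single_le_sum (f := fun i => d (p.str.take i)) (fun _ _ => Nat.zero_le _)
        (Finset.mem_range.2 (Nat.lt_succ_of_le hτ.length_le))
      rw [h1] at h2
      exact Nat.lt_succ_of_le h2
    refine ⟨⟨p.str, fun x => K * p.cap x + d x, K * p.bound, hadd _ p.cap_mem _ hd K, ?_⟩, ?_,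
      List.prefix_refl _, ?_⟩
    · intro τ hτ
      have h1 := p.safe τ hτ
      have h2 := hK τ hτ
      calc K * p.cap τ + d τ < K * (p.cap τ + 1) := by rw [mul_add, mul_one]; omega
        _ ≤ K * (p.bound * 2 ^ τ.length) := Nat.mul_le_mul_left _ h1
        _ = _ := by ring
    · exact ⟨K * p.bound, fun x hx => (Nat.le_add_left _ _).trans_lt hx⟩
    · intro x hx
      have : K * p.cap x < K * (p.bound * 2 ^ x.length) := by
        rw [← mul_assoc]; exact (Nat.le_add_right _ _).trans_lt hx
      exact Nat.lt_of_mul_lt_mul_left this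
  let F : ι ⊕ ℕ ⊕ D → Order.Cofinal (Condition D)
    | .inl j => ⟨_, cof_req j⟩
    | .inr (.inl n) => ⟨_, cof_len n⟩
    | .inr (.inr d) => ⟨_, cof_cap d⟩
  let I := Order.idealOfCofinals p₀ F
  have meets := Order.cofinal_meets_idealOfCofinals p₀ F
  have hlen : ∀ n, ∃ p ∈ I, n ≤ p.str.length := fun n =>
    let ⟨p, h1, h2⟩ := meets (.inr (.inl n))
    ⟨p, h2, h1⟩
  choose q hqI hq using hlen
  -- Bit `n` is read off a condition of length greater than `n`, so the default value never matters;
  -- directedness of the ideal makes the choices consistent.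
  let α : ℕ → Bool := fun n => (q (n + 1)).str.getD n false
  have hstr : ∀ p ∈ I, p.str = initSeg α p.str.length := by
    intro p hp
    refine List.ext_getElem? fun n => ?_
    rw [getElem?_initSeg]
    split_ifs with hn
    · obtain ⟨r, -, hpr, hqr⟩ := I.directed p hp _ (hqI (n + 1))
      have h1 : n < (q (n + 1)).str.length := hq (n + 1)
      have h2 : α n = (q (n + 1)).str[n] := by simp [α, h1]
      rw [h2, List.getElem?_eq_getElem hn, hpr.1.getElem hn, hqr.1.getElem h1]
    · exact List.getElem?_eq_none (not_lt.1 hn)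
  have hsafe : ∀ p ∈ I, ∀ m, Safe p.cap p.bound (initSeg α m) := by
    intro p hp m τ hτ
    obtain ⟨r, hr, hpr, hqr⟩ := I.directed p hp _ (hqI m)
    refine hpr.2 τ (r.safe τ (hτ.trans ?_))
    rw [hstr r hr]
    exact initSeg_prefix α ((hq m).trans hqr.1.length_le)
  refine ⟨α, fun d hd => ?_, fun j => ?_⟩
  · obtain ⟨p, ⟨C, hC⟩, hp⟩ := meets (.inr (.inr ⟨d, hd⟩))
    refine ⟨C, fun n => ?_⟩
    simpa using hC (initSeg α n) (hsafe p hp n _ (List.prefix_refl _))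
  · obtain ⟨p, h1, hp⟩ := meets (.inl j)
    refine ⟨p.str.length, Safe p.cap p.bound, ?_, hsafe p hp⟩
    rw [← hstr p hp]
    exact h1

/-! ### Halting times -/

/-- The program with number `L` halts on input `0` in exactly `s` steps. -/
def HaltsAt (L s : ℕ) : Prop :=
  (Nat.Partrec.Code.evaln (s + 1) (Denumerable.ofNat Nat.Partrec.Code L) 0).isSome = true ∧
    (Nat.Partrec.Code.evaln s (Denumerable.ofNat Nat.Partrec.Code L) 0).isSome = false

instance : DecidableRel HaltsAt := fun _ _ => by unfold HaltsAt; infer_instance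

lemma primrec_haltsAt : Primrec fun p : ℕ × ℕ => decide (HaltsAt p.1 p.2) := by
  have h : ∀ {f : ℕ × ℕ → ℕ}, Primrec f → Primrec fun p : ℕ × ℕ =>
      (Nat.Partrec.Code.evaln (f p) (Denumerable.ofNat Nat.Partrec.Code p.1) 0).isSome := by
    intro f hf
    exact Primrec.option_isSome.comp (Nat.Partrec.Code.primrec_evaln.comp
      (Primrec.pair (Primrec.pair hf ((Primrec.ofNat _).comp .fst)) (.const 0)))
  refine (Primrec.and.comp (h (Primrec.succ.comp .snd)) (Primrec.not.comp (h .snd))).of_eq ?_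
  intro p
  rw [Bool.eq_iff_iff]
  simp [HaltsAt]

lemma isSome_evaln_mono {c : Nat.Partrec.Code} {n s t : ℕ} (hst : s ≤ t)
    (h : (Nat.Partrec.Code.evaln s c n).isSome = true) :
    (Nat.Partrec.Code.evaln t c n).isSome = true := by
  obtain ⟨v, hv⟩ := Option.isSome_iff_exists.1 h
  exact Option.isSome_iff_exists.2 ⟨v, Nat.Partrec.Code.evaln_mono hst hv⟩

lemma HaltsAt.unique {L s t : ℕ} (hs : HaltsAt L s) (ht : HaltsAt L t) : s = t := by
  have : ∀ {s t}, HaltsAt L s → HaltsAt L t → s ≤ t := by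
    intro s t hs ht
    by_contra! hlt
    have := isSome_evaln_mono (Nat.succ_le_of_lt hlt) ht.1
    rw [hs.2] at this
    simp at this
  exact le_antisymm (this hs ht) (this ht hs)

lemma exists_haltsAt_of_isSome {L k : ℕ}
    (h : (Nat.Partrec.Code.evaln k (Denumerable.ofNat Nat.Partrec.Code L) 0).isSome = true) :
    ∃ s < k, HaltsAt L s := by
  induction k with
  | zero => simp [Nat.Partrec.Code.evaln] at h
  | succ k ih =>
    by_cases hk : (Nat.Partrec.Code.evaln k (Denumerable.ofNat Nat.Partrec.Code L) 0).isSome = true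
    · obtain ⟨s, hs, h1⟩ := ih hk
      exact ⟨s, hs.trans (Nat.lt_succ_self k), h1⟩
    · exact ⟨k, Nat.lt_succ_self k, h, by simpa using hk⟩

/-- No computable function bounds the halting times of almost all halting programs. -/
theorem exists_haltsAt_gt {t : ℕ → ℕ} (ht : Computable t) (m : ℕ) :
    ∃ L ≥ m, ∃ s > t L, HaltsAt L s := by
  by_contra! hc
  -- The finitely many programs below `m` cost only an additive constant, so a bound for almost all
  -- programs would give one for all and decide the halting problem.
  have hB : ∃ B, ∀ L < m, ∀ s, HaltsAt L s → s ≤ B := by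
    clear hc
    induction m with
    | zero => exact ⟨0, by simp⟩
    | succ m ih =>
      obtain ⟨B, hB⟩ := ih
      by_cases h : ∃ s, HaltsAt m s
      · obtain ⟨s, hs⟩ := h
        refine ⟨max B s, fun L hL s' hs' => ?_⟩
        rcases Nat.lt_succ_iff_lt_or_eq.1 hL with hL | rfl
        · exact (hB L hL s' hs').trans (le_max_left _ _)
        · exact (hs'.unique hs).le.trans (le_max_right _ _)
      · refine ⟨B, fun L hL s' hs' => ?_⟩
        rcases Nat.lt_succ_iff_lt_or_eq.1 hL with hL | rfl
        · exact hB L hL s' hs'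
        · exact absurd ⟨s', hs'⟩ h
  obtain ⟨B, hB⟩ := hB
  have hbound : ∀ L s, HaltsAt L s → s < t L + B + 1 := by
    intro L s hs
    rcases lt_or_ge L m with hL | hL
    · have := hB L hL s hs
      omega
    · have : ¬ s > t L := fun h => hc L hL s h hs
      omega
  have key : ∀ c : Nat.Partrec.Code, (c.eval 0).Dom ↔
      (Nat.Partrec.Code.evaln (t (Encodable.encode c) + B + 1) c 0).isSome = true := by
    intro c
    rw [Part.dom_iff_mem, Option.isSome_iff_exists]
    constructor
    · rintro ⟨v, hv⟩
      obtain ⟨k, hk⟩ := Nat.Partrec.Code.evaln_complete.1 hv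
      have h1 : (Nat.Partrec.Code.evaln k (Denumerable.ofNat Nat.Partrec.Code
          (Encodable.encode c)) 0).isSome = true := by
        rw [Denumerable.ofNat_encode]
        exact Option.isSome_iff_exists.2 ⟨v, hk⟩
      obtain ⟨s, -, hs⟩ := exists_haltsAt_of_isSome h1
      have h2 := isSome_evaln_mono (Nat.succ_le_of_lt (hbound _ _ hs)) hs.1
      rw [Denumerable.ofNat_encode] at h2
      exact Option.isSome_iff_exists.1 h2
    · rintro ⟨v, hv⟩
      exact ⟨v, Nat.Partrec.Code.evaln_sound hv⟩
  refine ComputablePred.halting_problem 0 ?_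
  refine (ComputablePred.of_eq (p := fun c => (Nat.Partrec.Code.evaln
    (t (Encodable.encode c) + B + 1) c 0).isSome = true) ?_ fun c => (key c).symm)
  refine Computable.computablePred ?_
  have h1 : Computable fun c : Nat.Partrec.Code => t (Encodable.encode c) + B + 1 :=
    (Primrec.nat_add.comp (Primrec.nat_add.comp .id (.const B)) (.const 1)).to_comp.comp
      (ht.comp .encode)
  have h2 := (Primrec.option_isSome.comp Nat.Partrec.Code.primrec_evaln).to_comp.comp
    (Computable.pair (Computable.pair h1 .id) (Computable.const 0))
  exact h2.of_eq fun c => by simp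

/-! ### The first sequence -/

lemma exists_computable_choice {p : ℕ → ℕ → Bool} (hp : Computable₂ p)
    (h : ∀ L, ∃ k, p L k = true) : ∃ g : ℕ → ℕ, Computable g ∧ ∀ L, p L (g L) = true := by
  refine ⟨fun L => Nat.find (h L), ?_, fun L => Nat.find_spec (h L)⟩
  have h1 : Partrec fun L => Nat.rfind fun k => Part.some (p L k) := Partrec.rfind hp.partrec₂
  refine h1.of_eq_tot fun L => Nat.mem_rfind.2 ⟨?_, fun {k} hk => ?_⟩
  · simpa using (Nat.find_spec (h L)).symm
  · simpa using (Nat.find_min (h L) hk)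

lemma computable_forall_lt {α : Type*} [Primcodable α] {p : α → ℕ → Bool} (hp : Computable₂ p)
    {n : α → ℕ} (hn : Computable n) : Computable fun a => decide (∀ i < n a, p a i = true) := by
  have h : Computable fun a => (Nat.rec true (fun i b => b && p a i) (n a) : Bool) := by
    refine Computable.nat_rec hn (.const true) (h := fun a q => q.2 && p a q.1) ?_
    exact Primrec.and.to_comp.comp (Computable.snd.comp .snd)
      (hp.comp .fst (Computable.fst.comp .snd))
  refine h.of_eq fun a => ?_
  generalize n a = k
  induction k with
  | zero => simp
  | succ k ih =>
    rw [Bool.eq_iff_iff]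
    simp only [ih, Bool.and_eq_true, decide_eq_true_eq, Nat.lt_succ_iff_lt_or_eq, or_imp,
      forall_and, forall_eq]

lemma safe_iff_forall_lt {d : List Bool → ℕ} {C : ℕ} {σ : List Bool} :
    Safe d C σ ↔ ∀ i < σ.length + 1, d (σ.take i) < C * 2 ^ i := by
  constructor
  · intro h i hi
    simpa [Nat.min_eq_left (Nat.lt_succ_iff.1 hi)] using h _ (List.take_prefix i σ)
  · intro h τ hτ
    rw [List.prefix_iff_eq_take.1 hτ]
    simpa [Nat.min_eq_left hτ.length_le] using h _ (Nat.lt_succ_of_le hτ.length_le)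

instance (d : List Bool → ℕ) (C : ℕ) : DecidablePred (Safe d C) := fun _ =>
  decidable_of_iff _ safe_iff_forall_lt.symm

lemma primrec_pow : Primrec₂ ((· ^ ·) : ℕ → ℕ → ℕ) :=
  Primrec₂.unpaired'.1 Nat.Primrec.pow

lemma computable_safe {d : List Bool → ℕ} (hd : Computable d) (C : ℕ) :
    Computable fun σ => decide (Safe d C σ) := by
  have h := computable_forall_lt (α := List Bool) (n := fun σ => σ.length + 1)
    (p := fun σ i => decide (d (σ.take i) < C * 2 ^ i)) ?_
    (Primrec.succ.comp .list_length).to_comp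
  · refine h.of_eq fun σ => ?_
    rw [decide_eq_decide, safe_iff_forall_lt]
    simp
  · exact Primrec.nat_lt.decide.to_comp.comp
      (hd.comp (Primrec.list_take.to_comp.comp .snd .fst))
      ((Primrec.nat_mul.comp (.const C) (primrec_pow.comp (.const 2) .snd)).to_comp)

lemma isIntSupermartingale_mul_add {d d' : List Bool → ℕ} (hd : IsIntSupermartingale d)
    (hd' : IsIntSupermartingale d') (K : ℕ) : IsIntSupermartingale fun x => K * d x + d' x := by
  intro x
  have := Nat.mul_le_mul_left K (hd x)
  have := hd' x
  simp only
  linarith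

/-- A sequence on which all computable supermartingales are bounded, and such that no function
computable from it bounds the halting times of almost all halting programs. The latter is stated
through the finite parts of the oracle that a computation uses. -/
theorem exists_random_of_weak_oracle :
    ∃ α : ℕ → Bool, (∀ d, Computable d → IsIntSupermartingale d → IntBoundedOn d α) ∧
      ∀ P : ℕ × List Bool → Bool, Computable P →
        (∀ L, ∃ n₀, ∀ n ≥ n₀, P (L, initSeg α n) = true) →
        ∀ m, ∃ L ≥ m, ∃ s, HaltsAt L s ∧ ∃ n < s, P (L, initSeg α n) = true := by
  let D : Set (List Bool → ℕ) := {d | Computable d ∧ IsIntSupermartingale d}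
  have : Countable {P : ℕ × List Bool → Bool | Computable P} :=
    (countable_computable _ _).to_subtype
  -- Either `P` fails at some `L` on all safe extensions, so that it is not eventually true along
  -- the sequence, or it already holds on a string shorter than the halting time of some `L` ≥ `m`.
  let R : {P : ℕ × List Bool → Bool | Computable P} × ℕ → List Bool → (List Bool → Prop) → Prop :=
    fun j σ S => (∃ L, ∀ ρ, σ <+: ρ → S ρ → j.1.1 (L, ρ) = false) ∨
      ∃ L ≥ j.2, ∃ s, HaltsAt L s ∧ σ.length < s ∧ j.1.1 (L, σ) = true
  have hR : ∀ j, ∀ d ∈ D, ∀ C σ, Safe d C σ →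
      ∃ σ', σ <+: σ' ∧ Safe d C σ' ∧ R j σ' (Safe d C) := by
    rintro ⟨⟨P, hP⟩, m⟩ d ⟨hd, -⟩ C σ hσ
    by_cases hcase : ∃ L τ, σ <+: τ ∧ Safe d C τ ∧ ∀ ρ, τ <+: ρ → Safe d C ρ → P (L, ρ) = false
    · obtain ⟨L, τ, hτ, hs, h⟩ := hcase
      exact ⟨τ, hτ, hs, .inl ⟨L, h⟩⟩
    · push Not at hcase
      -- In the remaining case every `L` has a safe extension of `σ` satisfying `P`. Extensions are
      -- searched by code `k`; a code that does not decode stands for the empty extension.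
      have hex : ∀ L, ∃ k, (decide (Safe d C (σ ++ (Encodable.decode k).getD [])) &&
          P (L, σ ++ (Encodable.decode k).getD [])) = true := by
        intro L
        obtain ⟨ρ, ⟨τ, rfl⟩, hs, hP⟩ := hcase L σ (List.prefix_refl σ) hσ
        exact ⟨Encodable.encode τ, by simpa using ⟨hs, Bool.eq_true_of_not_eq_false hP⟩⟩
      have hext : Computable fun k => σ ++ (Encodable.decode k).getD [] :=
        (Primrec.list_append.comp (.const σ)
          (Primrec.option_getD.comp .decode (.const []))).to_comp
      obtain ⟨g, hg, hgL⟩ := exists_computable_choice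
        (p := fun L k => decide (Safe d C (σ ++ (Encodable.decode k).getD [])) &&
          P (L, σ ++ (Encodable.decode k).getD []))
        (Primrec.and.to_comp.comp ((computable_safe hd C).comp (hext.comp .snd))
          (hP.comp (.pair .fst (hext.comp .snd)))) hex
      -- The length of the extension found is a computable function of `L`, so some halting time
      -- exceeds it.
      obtain ⟨L, hL, s, hs, hh⟩ := exists_haltsAt_gt
        (Computable.list_length.comp (hext.comp hg)) m
      have h3 := hgL L
      simp only [Bool.and_eq_true, decide_eq_true_eq] at h3
      exact ⟨_, List.prefix_append _ _, h3.1, .inr ⟨L, hL, s, hh, hs, h3.2⟩⟩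
  obtain ⟨α, h1, h2⟩ := exists_generic (D := D)
    ((countable_computable _ _).mono fun d hd => hd.1)
    ⟨fun _ => 0, .const 0, fun _ => by simp⟩ (fun d hd => hd.2)
    (fun d hd d' hd' K => ⟨Primrec.nat_add.to_comp.comp
      (Primrec.nat_mul.to_comp.comp (.const K) hd.1) hd'.1,
      isIntSupermartingale_mul_add hd.2 hd'.2 K⟩)
    R hR
  refine ⟨α, fun d hd hd' => h1 d ⟨hd, hd'⟩, fun P hP htot m => ?_⟩
  obtain ⟨n, S, hR | hR, hS⟩ := h2 (⟨P, hP⟩, m)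
  · obtain ⟨L, hL⟩ := hR
    obtain ⟨n₀, hn₀⟩ := htot L
    have h3 := hn₀ (max n n₀) (le_max_right _ _)
    exact absurd h3 (Bool.eq_false_iff.1 (hL _ (initSeg_prefix α (le_max_left _ _)) (hS _)))
  · obtain ⟨L, hL, s, hs, hlt, hPL⟩ := hR
    exact ⟨L, hL, s, hs, n, by simpa using hlt, hPL⟩

/-! ### The gambler who plays against the first sequence -/

/-- The capital of a gambler who starts with `c` and at each string `x` pays the stake `A x` and
receives `B x b` if the next bit is `b`, as long as the capital covers the stake. All amounts at
strings of length `n` are in units of `2 ^ (-n)`. -/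
def gamble (A : List Bool → ℕ) (B : List Bool → Bool → ℕ) (c : ℕ) (x : List Bool) : ℕ :=
  (x.foldl (fun p b => (p.1 ++ [b],
    if A p.1 ≤ p.2 then 2 * (p.2 - A p.1) + B p.1 b else 2 * p.2)) (([] : List Bool), c)).2

section gamble

variable {A : List Bool → ℕ} {B : List Bool → Bool → ℕ} {c : ℕ}

lemma gamble_nil : gamble A B c [] = c := rfl

lemma gamble_concat (x : List Bool) (b : Bool) : gamble A B c (x ++ [b]) =
    if A x ≤ gamble A B c x then 2 * (gamble A B c x - A x) + B x b else 2 * gamble A B c x := by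
  have h : ∀ x : List Bool, (x.foldl (fun p b => (p.1 ++ [b],
      if A p.1 ≤ p.2 then 2 * (p.2 - A p.1) + B p.1 b else 2 * p.2))
      (([] : List Bool), c)).1 = x := by
    intro x
    induction x using List.reverseRecOn with
    | nil => rfl
    | append_singleton x b ih => simp [List.foldl_append, ih]
  simp only [gamble, List.foldl_append, List.foldl_cons, List.foldl_nil, h]
  rfl

lemma isIntSupermartingale_gamble (h : ∀ x, B x false + B x true ≤ 4 * A x) :
    IsIntSupermartingale (gamble A B c) := by
  intro x
  have := h x
  simp only [gamble_concat]
  split_ifs <;> omega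

lemma primrec_gamble (hA : Primrec A) (hB : Primrec₂ B) : Primrec (gamble A B c) := by
  have hA' : Primrec fun q : List Bool × (List Bool × ℕ) × Bool => A q.2.1.1 :=
    hA.comp (Primrec.fst.comp (Primrec.fst.comp .snd))
  have hv : Primrec fun q : List Bool × (List Bool × ℕ) × Bool => q.2.1.2 :=
    Primrec.snd.comp (Primrec.fst.comp .snd)
  refine Primrec.snd.comp (Primrec.list_foldl .id (.const (([] : List Bool), c))
    (h := fun _ q => (q.1.1 ++ [q.2],
      if A q.1.1 ≤ q.1.2 then 2 * (q.1.2 - A q.1.1) + B q.1.1 q.2 else 2 * q.1.2)) ?_)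
  refine Primrec.pair (Primrec.list_concat.comp (Primrec.fst.comp (Primrec.fst.comp .snd))
    (Primrec.snd.comp .snd)) (Primrec.ite (Primrec.nat_le.comp hA' hv) ?_ ?_)
  · exact Primrec.nat_add.comp (Primrec.nat_mul.comp (.const 2) (Primrec.nat_sub.comp hv hA'))
      (hB.comp (Primrec.fst.comp (Primrec.fst.comp .snd)) (Primrec.snd.comp .snd))
  · exact Primrec.nat_mul.comp (.const 2) hv

end gamble

/-- The value computed by `e` from the partial oracle `ρ`, with default value `0`. -/
def approx (e : List Bool → List Bool → Option ℕ) (ρ x : List Bool) : ℕ := (e ρ x).getD 0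

/-- Extend `γ` by `n` bits, along which the approximated supermartingale does not grow. -/
def greedy (e : List Bool → List Bool → Option ℕ) (γ ρ : List Bool) (n : ℕ) : List Bool :=
  Nat.rec γ (fun _ u => u ++ [decide (2 * approx e ρ u < approx e ρ (u ++ [false]))]) n

/-- All strings of length at most `n`. -/
def stringsUpTo (n : ℕ) : List (List Bool) :=
  Nat.rec [[]] (fun _ l => [] :: l.flatMap fun x => [x ++ [false], x ++ [true]]) n

lemma mem_stringsUpTo {x : List Bool} {n : ℕ} (h : x.length ≤ n) : x ∈ stringsUpTo n := by
  induction n generalizing x with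
  | zero => simp [stringsUpTo, List.length_eq_zero_iff.1 (Nat.le_zero.1 h)]
  | succ n ih =>
    rcases List.eq_nil_or_concat' x with rfl | ⟨y, b, rfl⟩
    · exact List.mem_cons_self
    · refine List.mem_cons_of_mem _ (List.mem_flatMap.2 ⟨y, ih (by simpa using h), ?_⟩)
      cases b <;> simp

/-- The partial oracle `ρ` determines the values at all strings of length at most `2 * L`. -/
def Settled (e : List Bool → List Bool → Option ℕ) (L : ℕ) (ρ : List Bool) : Prop :=
  ∀ x ∈ stringsUpTo (2 * L), (e ρ x).isSome = true

/-- The bits of `α` at the positions `a, …, a + n - 1`. -/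
def block (α : ℕ → Bool) (a n : ℕ) : List Bool := (List.range n).map fun i => α (a + i)

@[simp] lemma length_block (α : ℕ → Bool) (a n : ℕ) : (block α a n).length = n := by simp [block]

lemma block_succ (α : ℕ → Bool) (a n : ℕ) : block α a (n + 1) = block α a n ++ [α (a + n)] := by
  simp [block, List.range_succ]

lemma drop_initSeg_add (α : ℕ → Bool) (a n : ℕ) : (initSeg α (a + n)).drop a = block α a n := by
  have : initSeg α (a + n) = initSeg α a ++ block α a n := by
    simp [initSeg, block, List.range_add, Function.comp_def]
  rw [this, List.drop_left' (length_initSeg α a)]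

/-- The string on whose next bit the gambler imitates the opponent's supermartingale, when the
known part of the oracle is `x`. -/
def target (e : List Bool → List Bool → Option ℕ) (γ x : List Bool) : List Bool :=
  greedy e γ (x.take x.length.sqrt) (x.length.sqrt.unpair.1 - γ.length) ++
    x.drop (x.length.sqrt * x.length.sqrt)

/-- The condition under which the gambler bets. -/
def Active (e : List Bool → List Bool → Option ℕ) (γ : List Bool) (C m : ℕ) (x : List Bool) :
    Prop :=
  m ≤ x.length.sqrt.unpair.1 ∧ HaltsAt x.length.sqrt.unpair.1 x.length.sqrt.unpair.2 ∧
  x.length < x.length.sqrt * x.length.sqrt + x.length.sqrt.unpair.1 ∧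
  Settled e x.length.sqrt.unpair.1 (x.take x.length.sqrt) ∧
  Safe (approx e (x.take x.length.sqrt)) C (target e γ x) ∧
  approx e (x.take x.length.sqrt) (target e γ x ++ [false]) +
    approx e (x.take x.length.sqrt) (target e γ x ++ [true]) ≤
    4 * approx e (x.take x.length.sqrt) (target e γ x)

open Classical in
/-- The stake at `x`. -/
noncomputable def stake (e : List Bool → List Bool → Option ℕ) (γ : List Bool) (C m : ℕ)
    (x : List Bool) : ℕ :=
  if Active e γ C m x then
    2 ^ (x.length - (target e γ x).length) * approx e (x.take x.length.sqrt) (target e γ x)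
  else 0

open Classical in
/-- The payoff at `x` when the next bit is `b`. -/
noncomputable def payoff (e : List Bool → List Bool → Option ℕ) (γ : List Bool) (C m : ℕ)
    (x : List Bool) (b : Bool) : ℕ :=
  if Active e γ C m x then
    2 ^ (x.length - (target e γ x).length) *
      approx e (x.take x.length.sqrt) (target e γ x ++ [b])
  else 0

/-- The last clause of `Active` tests the needed inequality. The test matters because `e` may be
wrong on strings that are not prefixes of α, while the bets must be fair on every string. -/
lemma payoff_add_le (e : List Bool → List Bool → Option ℕ) (γ : List Bool) (C m : ℕ)
    (x : List Bool) :
    payoff e γ C m x false + payoff e γ C m x true ≤ 4 * stake e γ C m x := by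
  unfold payoff stake
  split_ifs with h
  · rw [← mul_add, mul_left_comm]
    exact Nat.mul_le_mul_left _ h.2.2.2.2.2
  · simp

section primrec

variable {e : List Bool → List Bool → Option ℕ} {γ : List Bool} {C m : ℕ}
variable {σ : Type*} [Primcodable σ]

lemma primrec_approx (he : Primrec₂ e) {f g : σ → List Bool} (hf : Primrec f) (hg : Primrec g) :
    Primrec fun a => approx e (f a) (g a) :=
  Primrec.option_getD.comp (he.comp hf hg) (.const 0)

lemma primrec_greedy (he : Primrec₂ e) : Primrec₂ (greedy e γ) := by
  refine Primrec.nat_rec' .snd (.const γ) (h := fun p q =>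
    q.2 ++ [decide (2 * approx e p.1 q.2 <
      approx e p.1 (q.2 ++ [false]))]) ?_
  have hu : Primrec fun a : (List Bool × ℕ) × ℕ × List Bool => a.2.2 := Primrec.snd.comp .snd
  have hρ : Primrec fun a : (List Bool × ℕ) × ℕ × List Bool => a.1.1 := Primrec.fst.comp .fst
  exact Primrec.list_concat.comp hu (Primrec.nat_lt.decide.comp
    (Primrec.nat_mul.comp (.const 2) (primrec_approx he hρ hu))
    (primrec_approx he hρ (Primrec.list_concat.comp hu (.const false))))

lemma primrec_stringsUpTo : Primrec stringsUpTo := by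
  refine Primrec.nat_rec₁ _ (Primrec.list_cons.comp (.const []) ?_)
  refine Primrec.list_flatMap .snd ?_
  have h : ∀ b : Bool, Primrec fun a : (ℕ × List (List Bool)) × List Bool => a.2 ++ [b] :=
    fun b => Primrec.list_concat.comp .snd (.const b)
  exact Primrec.list_cons.comp (h false) (Primrec.list_cons.comp (h true) (.const []))

lemma primrecRel_settled (he : Primrec₂ e) : PrimrecRel (Settled e) := by
  have h : PrimrecRel fun x ρ : List Bool => (e ρ x).isSome = true :=
    Primrec.eq.comp (Primrec.option_isSome.comp (he.comp .snd .fst)) (.const true)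
  exact h.forall_mem_list.comp (primrec_stringsUpTo.comp
    (Primrec.nat_mul.comp (.const 2) .fst)) .snd

lemma primrecRel_safe_approx (he : Primrec₂ e) :
    PrimrecRel fun ρ u => Safe (approx e ρ) C u := by
  have h : PrimrecRel fun (i : ℕ) (p : List Bool × List Bool) =>
      approx e p.1 (p.2.take i) < C * 2 ^ i :=
    Primrec.nat_lt.comp (primrec_approx he (Primrec.fst.comp .snd)
        (Primrec.list_take.comp .fst (Primrec.snd.comp .snd)))
      (Primrec.nat_mul.comp (.const C) (primrec_pow.comp (.const 2) .fst))
  have h' : PrimrecPred fun p : List Bool × List Bool => ∀ i ∈ List.range (p.2.length + 1),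
      approx e p.1 (p.2.take i) < C * 2 ^ i :=
    h.forall_mem_list.comp (Primrec.list_range.comp
      (Primrec.succ.comp (Primrec.list_length.comp .snd))) .id
  refine h'.of_eq fun p => ?_
  simp only [List.mem_range]
  exact safe_iff_forall_lt.symm

lemma primrec_target (he : Primrec₂ e) : Primrec (target e γ) := by
  have hq : Primrec fun x : List Bool => x.length.sqrt := Primrec.nat_sqrt.comp .list_length
  exact Primrec.list_append.comp ((primrec_greedy he).comp (Primrec.list_take.comp hq .id)
      (Primrec.nat_sub.comp (Primrec.fst.comp (Primrec.unpair.comp hq)) (.const _)))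
    (Primrec.list_drop.comp (Primrec.nat_mul.comp hq hq) .id)

lemma primrec_take_sqrt : Primrec fun x : List Bool => x.take x.length.sqrt :=
  Primrec.list_take.comp (Primrec.nat_sqrt.comp .list_length) .id

lemma primrec_unit (he : Primrec₂ e) :
    Primrec fun x : List Bool => 2 ^ (x.length - (target e γ x).length) :=
  primrec_pow.comp (.const 2) (Primrec.nat_sub.comp .list_length
    (Primrec.list_length.comp (primrec_target he)))

lemma primrecPred_active (he : Primrec₂ e) : PrimrecPred (Active e γ C m) := by
  have hq : Primrec fun x : List Bool => x.length.sqrt := Primrec.nat_sqrt.comp .list_length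
  have hL := Primrec.fst.comp (Primrec.unpair.comp hq)
  have hs := Primrec.snd.comp (Primrec.unpair.comp hq)
  have ht := primrec_target (γ := γ) he
  have hb : ∀ b : Bool, Primrec fun x => target e γ x ++ [b] :=
    fun b => Primrec.list_concat.comp ht (.const b)
  have hr := primrec_take_sqrt
  refine (Primrec.nat_le.comp (.const m) hL).and (.and ?_ (.and ?_ (.and ?_ (.and ?_ ?_))))
  · exact Primrec.primrecPred (primrec_haltsAt.comp (hL.pair hs))
  · exact Primrec.nat_lt.comp .list_length (Primrec.nat_add.comp (Primrec.nat_mul.comp hq hq) hL)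
  · exact (primrecRel_settled he).comp hL hr
  · exact (primrecRel_safe_approx he).comp hr ht
  · exact Primrec.nat_le.comp (Primrec.nat_add.comp (primrec_approx he hr (hb false))
      (primrec_approx he hr (hb true))) (Primrec.nat_mul.comp (.const 4) (primrec_approx he hr ht))

lemma primrec_stake (he : Primrec₂ e) : Primrec (stake e γ C m) := by
  classical
  exact Primrec.ite (primrecPred_active he) (Primrec.nat_mul.comp (primrec_unit he)
    (primrec_approx he primrec_take_sqrt (primrec_target he))) (.const 0)

lemma primrec_payoff (he : Primrec₂ e) : Primrec₂ (payoff e γ C m) := by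
  classical
  exact Primrec.ite ((primrecPred_active he).comp .fst)
    (Primrec.nat_mul.comp ((primrec_unit he).comp .fst)
      (primrec_approx he (primrec_take_sqrt.comp .fst)
        (Primrec.list_concat.comp ((primrec_target he).comp .fst) .snd))) (.const 0)

end primrec

lemma length_greedy (e : List Bool → List Bool → Option ℕ) (γ ρ : List Bool) (n : ℕ) :
    (greedy e γ ρ n).length = γ.length + n := by
  induction n with
  | zero => rfl
  | succ n ih =>
    change (greedy e γ ρ n ++ [_]).length = _
    simp [ih, add_assoc]

lemma prefix_greedy (e : List Bool → List Bool → Option ℕ) (γ ρ : List Bool) (n : ℕ) :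
    γ <+: greedy e γ ρ n := by
  induction n with
  | zero => exact List.prefix_refl γ
  | succ n ih => exact ih.trans (List.prefix_append _ _)

/-- The two children sum to at most four times the parent, so one of them is at most twice the
parent, which means no growth after normalization. The greedy bit picks such a child. -/
lemma greedy_spec {e : List Bool → List Bool → Option ℕ} {d : List Bool → ℕ} {γ ρ : List Bool}
    {C : ℕ} (hd : IsIntSupermartingale d) (hγ : Safe d C γ) (n : ℕ)
    (h : ∀ x : List Bool, x.length ≤ γ.length + n → approx e ρ x = d x) :
    Safe d C (greedy e γ ρ n) ∧ d (greedy e γ ρ n) ≤ d γ * 2 ^ n := by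
  induction n with
  | zero => exact ⟨hγ, by simp [greedy]⟩
  | succ n ih =>
    obtain ⟨h1, h2⟩ := ih fun x hx => h x (hx.trans (by omega))
    have hlen := length_greedy e γ ρ n
    have hstep : greedy e γ ρ (n + 1) = greedy e γ ρ n ++
        [decide (2 * d (greedy e γ ρ n) < d (greedy e γ ρ n ++ [false]))] := by
      rw [← h _ (by omega), ← h _ (by simp [hlen, add_assoc])]
      rfl
    rw [hstep]
    generalize greedy e γ ρ n = u at h1 h2
    have h3 : d (u ++ [decide (2 * d u < d (u ++ [false]))]) ≤ 2 * d u := by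
      have := hd u
      by_cases hc : 2 * d u < d (u ++ [false])
      · simp only [hc, decide_true]
        omega
      · simp only [hc, decide_false]
        omega
    refine ⟨h1.concat ?_, ?_⟩
    · have := h1 u (List.prefix_refl u)
      rw [pow_succ]
      linarith
    · rw [pow_succ]
      linarith

/-- Positions q², …, q²+2q are those with integer square root `q`, so the position alone tells the
gambler which round is being played. -/
lemma target_initSeg (e : List Bool → List Bool → Option ℕ) (γ : List Bool) (α : ℕ → Bool)
    {q i : ℕ} (hi : i ≤ 2 * q) : target e γ (initSeg α (q * q + i)) =
      greedy e γ (initSeg α q) (q.unpair.1 - γ.length) ++ block α (q * q) i := by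
  have h1 : (q * q + i).sqrt = q := Nat.sqrt_add_eq q (by omega)
  have h2 : q ≤ q * q + i := (Nat.le_mul_self q).trans (Nat.le_add_right _ _)
  simp only [target, length_initSeg, h1, take_initSeg, Nat.min_eq_left h2, drop_initSeg_add]

lemma active_initSeg {e : List Bool → List Bool → Option ℕ} {γ : List Bool} {α : ℕ → Bool}
    {C m q i : ℕ} (hi : i ≤ 2 * q) {u : List Bool}
    (hu : u = greedy e γ (initSeg α q) (q.unpair.1 - γ.length) ++ block α (q * q) i) :
    Active e γ C m (initSeg α (q * q + i)) ↔
      m ≤ q.unpair.1 ∧ HaltsAt q.unpair.1 q.unpair.2 ∧ i < q.unpair.1 ∧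
      Settled e q.unpair.1 (initSeg α q) ∧ Safe (approx e (initSeg α q)) C u ∧
      approx e (initSeg α q) (u ++ [false]) + approx e (initSeg α q) (u ++ [true]) ≤
        4 * approx e (initSeg α q) u := by
  have h1 : (q * q + i).sqrt = q := Nat.sqrt_add_eq q (by omega)
  have h2 : q ≤ q * q + i := (Nat.le_mul_self q).trans (Nat.le_add_right _ _)
  subst hu
  simp only [Active, target_initSeg e γ α hi, length_initSeg, h1, take_initSeg,
    Nat.min_eq_left h2, Nat.add_lt_add_iff_left]

/-! ### One round of the game -/

/-- The gambler's capital along `α`. -/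
noncomputable def capital (e : List Bool → List Bool → Option ℕ) (γ : List Bool) (C m : ℕ)
    (α : ℕ → Bool) (k : ℕ) : ℝ :=
  gamble (stake e γ C m) (payoff e γ C m) C (initSeg α k) / 2 ^ k

section capital

variable {e : List Bool → List Bool → Option ℕ} {d : List Bool → ℕ} {γ : List Bool} {C m : ℕ}
  {α : ℕ → Bool}

lemma capital_succ_of_not_active {k : ℕ} (h : ¬ Active e γ C m (initSeg α k)) :
    capital e γ C m α (k + 1) = capital e γ C m α k := by
  simp only [capital, initSeg_succ, gamble_concat, stake, payoff, if_neg h, zero_le, if_true,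
    Nat.sub_zero, add_zero]
  rw [pow_succ]
  push_cast
  field_simp

lemma capital_eq_of_not_active {k n : ℕ} (hkn : k ≤ n)
    (h : ∀ j, k ≤ j → j < n → ¬ Active e γ C m (initSeg α j)) :
    capital e γ C m α n = capital e γ C m α k := by
  induction n, hkn using Nat.le_induction with
  | base => rfl
  | succ n hkn ih =>
    rw [capital_succ_of_not_active (h n hkn n.lt_succ_self),
      ih fun j h1 h2 => h j h1 (h2.trans n.lt_succ_self)]

/-- The value of the supermartingale `d / 2 ^ |·|`. -/
noncomputable def value (d : List Bool → ℕ) (x : List Bool) : ℝ := d x / 2 ^ x.length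

lemma unit_mul_div (a n k : ℕ) (h : n ≤ k) : ((2 ^ (k - n) * a : ℕ) : ℝ) / 2 ^ k = a / 2 ^ n := by
  obtain ⟨j, rfl⟩ := Nat.exists_eq_add_of_le h
  rw [Nat.add_sub_cancel_left, pow_add]
  push_cast
  field_simp

/-- The power of two in `stake` and `payoff` converts units of 2^(-|u|) into units of 2^(-(q² + i)).
In normalized terms the gambler pays the value at `u` and receives the value at the next string. -/
lemma capital_succ_of_active {q i : ℕ} (hi : i < q.unpair.1) (hm : γ.length ≤ m) {u : List Bool}
    (hu : u = greedy e γ (initSeg α q) (q.unpair.1 - γ.length) ++ block α (q * q) i)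
    (hact : Active e γ C m (initSeg α (q * q + i)))
    (h0 : approx e (initSeg α q) u = d u)
    (h1 : approx e (initSeg α q) (u ++ [α (q * q + i)]) = d (u ++ [α (q * q + i)]))
    (hcap : value d u ≤ capital e γ C m α (q * q + i)) :
    capital e γ C m α (q * q + (i + 1)) =
      capital e γ C m α (q * q + i) - value d u + value d (u ++ [α (q * q + i)]) := by
  have hLq : q.unpair.1 ≤ q := Nat.unpair_left_le q
  have hqq : q ≤ q * q := Nat.le_mul_self q
  have hi2 : i ≤ 2 * q := by omega
  have hact' := (active_initSeg hi2 hu).1 hact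
  have hlen : u.length = q.unpair.1 + i := by
    have := hact'.1
    rw [hu, List.length_append, length_greedy, length_block]
    omega
  have hsqrt : (q * q + i).sqrt = q := Nat.sqrt_add_eq q (by omega)
  have htake : (initSeg α (q * q + i)).take q = initSeg α q := by
    rw [take_initSeg, Nat.min_eq_left (by omega)]
  have htarget : target e γ (initSeg α (q * q + i)) = u := by rw [target_initSeg e γ α hi2, hu]
  have hA : stake e γ C m (initSeg α (q * q + i)) = 2 ^ (q * q + i - u.length) * d u := by
    simp only [stake, if_pos hact, htarget, length_initSeg, hsqrt, htake, h0]
  have hB : payoff e γ C m (initSeg α (q * q + i)) (α (q * q + i)) =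
      2 ^ (q * q + i - u.length) * d (u ++ [α (q * q + i)]) := by
    simp only [payoff, if_pos hact, htarget, length_initSeg, hsqrt, htake, h1]
  have hle : u.length ≤ q * q + i := by omega
  have hA' := unit_mul_div (d u) u.length (q * q + i) hle
  have hB' := unit_mul_div (d (u ++ [α (q * q + i)])) u.length (q * q + i) hle
  rw [← hA] at hA'
  rw [← hB] at hB'
  have hpos : (0 : ℝ) < 2 ^ (q * q + i) := by positivity
  have hcov : stake e γ C m (initSeg α (q * q + i)) ≤
      gamble (stake e γ C m) (payoff e γ C m) C (initSeg α (q * q + i)) := by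
    rw [value, ← hA', capital, div_le_div_iff_of_pos_right hpos] at hcap
    exact_mod_cast hcap
  have hval : value d (u ++ [α (q * q + i)]) =
      (payoff e γ C m (initSeg α (q * q + i)) (α (q * q + i)) : ℝ) / 2 ^ (q * q + i) / 2 := by
    rw [hB', value, List.length_append, List.length_singleton, pow_succ]
    field_simp
  rw [hval, value, ← hA', capital, capital, ← add_assoc, initSeg_succ, gamble_concat,
    if_pos hcov, pow_succ]
  push_cast [Nat.cast_sub hcov]
  field_simp

lemma Computes.approx_eq (he : Computes α e d) {L n : ℕ} (hs : Settled e L (initSeg α n))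
    {x : List Bool} (hx : x.length ≤ 2 * L) : approx e (initSeg α n) x = d x := by
  obtain ⟨v, hv⟩ := Option.isSome_iff_exists.1 (hs x (mem_stringsUpTo hx))
  rw [approx, hv, Option.getD_some]
  exact he.sound hv

/-- The round buys `d` at the greedy string, for at most its value at `γ`, follows it along the
block, and stops as soon as it reaches `C`, which `hno` guarantees. The gain is thus at least `C`
minus the value at `γ`. -/
lemma le_capital_of_active (he : Computes α e d) (hd : IsIntSupermartingale d)
    (hγ : Safe d C γ) (hm : γ.length ≤ m) {q : ℕ} (hL : m ≤ q.unpair.1)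
    (hH : HaltsAt q.unpair.1 q.unpair.2) (hs : Settled e q.unpair.1 (initSeg α q))
    (hno : ¬ Safe d C (greedy e γ (initSeg α q) (q.unpair.1 - γ.length) ++
      block α (q * q) q.unpair.1))
    (hcap : value d γ ≤ capital e γ C m α (q * q)) :
    capital e γ C m α (q * q) + (C - value d γ) ≤ capital e γ C m α ((q + 1) * (q + 1)) := by
  classical
  set L := q.unpair.1 with hLdef
  have hLq : L ≤ q := Nat.unpair_left_le q
  set u₀ := greedy e γ (initSeg α q) (L - γ.length) with hu₀
  have hlen₀ : u₀.length = L := by rw [hu₀, length_greedy]; omega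
  have happ : ∀ x : List Bool, x.length ≤ 2 * L → approx e (initSeg α q) x = d x :=
    fun x => he.approx_eq hs
  obtain ⟨hsafe₀, hval₀⟩ := greedy_spec (e := e) (ρ := initSeg α q) hd hγ (L - γ.length)
    fun x hx => happ x (by omega)
  rw [← hu₀] at hsafe₀ hval₀
  have hval : value d u₀ ≤ value d γ := by
    have : u₀.length = γ.length + (L - γ.length) := by omega
    rw [value, value, this, pow_add, div_le_div_iff₀ (by positivity) (by positivity)]
    have h : (d u₀ : ℝ) ≤ d γ * 2 ^ (L - γ.length) := by exact_mod_cast hval₀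
    nlinarith [pow_pos (two_pos : (0 : ℝ) < 2) γ.length]
  -- The first unsafe prefix of the block has length `j + 1`, since the greedy string itself is
  -- safe; the gambler bets at the offsets 0, …, `j`.
  have hex : ∃ i, ¬ Safe d C (u₀ ++ block α (q * q) i) := ⟨L, hno⟩
  obtain ⟨j, hj⟩ : ∃ j, Nat.find hex = j + 1 := by
    refine Nat.exists_eq_succ_of_ne_zero fun h0 => ?_
    have := Nat.find_spec hex
    rw [h0] at this
    exact this (by simpa [block] using hsafe₀)
  have hbad : ¬ Safe d C (u₀ ++ block α (q * q) (j + 1)) := hj ▸ Nat.find_spec hex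
  have hgood : ∀ i ≤ j, Safe d C (u₀ ++ block α (q * q) i) := fun i hi =>
    not_not.1 (Nat.find_min hex (by omega))
  have hjL : j + 1 ≤ L := hj ▸ Nat.find_min' hex hno
  have hlen : ∀ i, (u₀ ++ block α (q * q) i).length = L + i := fun i => by simp [hlen₀]
  have hsafe_iff : ∀ x : List Bool, x.length ≤ 2 * L →
      (Safe (approx e (initSeg α q)) C x ↔ Safe d C x) := by
    intro x hx
    refine forall₂_congr fun τ hτ => ?_
    rw [happ τ (hτ.length_le.trans hx)]
  have hactive : ∀ i ≤ j, Active e γ C m (initSeg α (q * q + i)) := by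
    intro i hi
    refine (active_initSeg (u := u₀ ++ block α (q * q) i) (by omega) rfl).2 ⟨hL, hH, by omega, hs, ?_, ?_⟩
    · exact (hsafe_iff _ (by rw [hlen]; omega)).2 (hgood i hi)
    · rw [happ _ (by simp [hlen₀]; omega), happ _ (by simp [hlen₀]; omega),
        happ _ (by simp [hlen₀]; omega)]
      exact hd _
  have hinactive : ∀ i, j < i → i ≤ 2 * q → ¬ Active e γ C m (initSeg α (q * q + i)) := by
    intro i hi hiq hact
    obtain ⟨-, -, hiL, -, hsafe, -⟩ := (active_initSeg hiq rfl).1 hact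
    refine hbad (((hsafe_iff _ (by rw [hlen]; omega)).1 hsafe).of_prefix ?_)
    rw [List.prefix_append_right_inj, List.prefix_iff_eq_take]
    simp only [block, ← List.map_take, List.take_range, List.length_map, List.length_range]
    rw [Nat.min_eq_left hi]
  -- The capital equals the current value of `d` plus a reserve that is nonnegative because `value d
  -- u₀ ≤ value d γ`, so every stake is covered.
  have hrun : ∀ i ≤ j + 1, capital e γ C m α (q * q + i) =
      capital e γ C m α (q * q) - value d u₀ + value d (u₀ ++ block α (q * q) i) := by
    intro i hi
    induction i with
    | zero => simp [block]
    | succ i ih =>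
      have ih := ih (by omega)
      have hpos : 0 ≤ value d (u₀ ++ block α (q * q) i) := by unfold value; positivity
      rw [capital_succ_of_active (u := u₀ ++ block α (q * q) i) (by omega) hm rfl (hactive i (by omega))
        (happ _ (by rw [hlen]; omega)) (happ _ (by simp [hlen₀]; omega)) (by linarith), ih,
        block_succ, List.append_assoc]
      ring
  have hwin : (C : ℝ) ≤ value d (u₀ ++ block α (q * q) (j + 1)) := by
    have h1 := mt (hgood j le_rfl).concat
      (by rwa [block_succ, ← List.append_assoc] at hbad)
    rw [List.append_assoc, ← block_succ, not_lt, hlen] at h1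
    rw [value, le_div_iff₀ (by positivity), hlen, ← add_assoc]
    exact_mod_cast h1
  have hend : capital e γ C m α ((q + 1) * (q + 1)) = capital e γ C m α (q * q + (j + 1)) := by
    refine capital_eq_of_not_active (by nlinarith) fun k hk1 hk2 => ?_
    obtain ⟨i, rfl⟩ := Nat.exists_eq_add_of_le hk1
    rw [add_assoc]
    exact hinactive _ (by omega) (by nlinarith)
  rw [hend, hrun _ le_rfl]
  linarith

end capital

/-- A condition for the even bits can be extended to one that contains a block copied from `α`. -/
theorem exists_extension_with_block {α : ℕ → Bool}
    (hrand : ∀ d, Computable d → IsIntSupermartingale d → IntBoundedOn d α)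
    (hweak : ∀ P : ℕ × List Bool → Bool, Computable P →
        (∀ L, ∃ n₀, ∀ n ≥ n₀, P (L, initSeg α n) = true) →
        ∀ m, ∃ L ≥ m, ∃ s, HaltsAt L s ∧ ∃ n < s, P (L, initSeg α n) = true)
    {e : List Bool → List Bool → Option ℕ} {d : List Bool → ℕ} (he : Computes α e d)
    (hd : IsIntSupermartingale d) {C : ℕ} {γ : List Bool} (hγ : Safe d C γ) (m : ℕ) :
    ∃ L ≥ m, ∃ s, HaltsAt L s ∧ ∃ u : List Bool, u.length = L ∧ γ <+: u ∧
      Safe d C (u ++ block α (Nat.pair L s * Nat.pair L s) L) := by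
  classical
  by_contra! hno
  -- Rounds with L < |γ| are skipped, so that the greedy extension of `γ` has length exactly L.
  set m' := max m γ.length with hm'
  have hmγ : γ.length ≤ m' := le_max_right _ _
  obtain ⟨B, hB⟩ := hrand _ (primrec_gamble (c := C) (primrec_stake (γ := γ) (C := C) (m := m')
    he.primrec) (primrec_payoff he.primrec)).to_comp
    (isIntSupermartingale_gamble (payoff_add_le e γ C m'))
  have hBcap : ∀ k, capital e γ C m' α k < B := by
    intro k
    rw [capital, div_lt_iff₀ (by positivity)]
    exact_mod_cast hB k
  have hgap : value d γ < C := by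
    rw [value, div_lt_iff₀ (by positivity)]
    exact_mod_cast hγ γ (List.prefix_refl γ)
  have hgain : ∀ q, m' ≤ q.unpair.1 → HaltsAt q.unpair.1 q.unpair.2 →
      Settled e q.unpair.1 (initSeg α q) → value d γ ≤ capital e γ C m' α (q * q) →
      capital e γ C m' α (q * q) + (C - value d γ) ≤
        capital e γ C m' α ((q + 1) * (q + 1)) := by
    intro q hL hH hs hcap
    refine le_capital_of_active he hd hγ hmγ hL hH hs ?_ hcap
    have := hno q.unpair.1 ((le_max_left _ _).trans hL) q.unpair.2 hH
      (greedy e γ (initSeg α q) (q.unpair.1 - γ.length)) (by rw [length_greedy]; omega)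
      (prefix_greedy _ _ _ _)
    rwa [Nat.pair_unpair] at this
  have hmono : ∀ q, value d γ ≤ capital e γ C m' α (q * q) →
      capital e γ C m' α (q * q) ≤ capital e γ C m' α ((q + 1) * (q + 1)) := by
    intro q hcap
    by_cases h : m' ≤ q.unpair.1 ∧ HaltsAt q.unpair.1 q.unpair.2 ∧
        Settled e q.unpair.1 (initSeg α q)
    · have := hgain q h.1 h.2.1 h.2.2 hcap
      linarith
    · refine (capital_eq_of_not_active (by nlinarith) fun k hk1 hk2 hact => h ?_).ge
      obtain ⟨i, rfl⟩ := Nat.exists_eq_add_of_le hk1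
      obtain ⟨h1, h2, -, h3, -⟩ := (active_initSeg (by nlinarith) rfl).1 hact
      exact ⟨h1, h2, h3⟩
  have hge : ∀ q, value d γ ≤ capital e γ C m' α (q * q) := by
    intro q
    induction q with
    | zero => simpa [capital, gamble_nil] using hgap.le
    | succ q ih => exact ih.trans (hmono q ih)
  have hmono' : Monotone fun q => capital e γ C m' α (q * q) :=
    monotone_nat_of_le_succ fun q => hmono q (hge q)
  have hsettled_mono : ∀ {L n k}, n ≤ k → Settled e L (initSeg α n) →
      Settled e L (initSeg α k) := by
    intro L n k hnk h x hx
    obtain ⟨v, hv⟩ := Option.isSome_iff_exists.1 (h x hx)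
    exact Option.isSome_iff_exists.2 ⟨v, he.mono hnk hv⟩
  have hsettled : ∀ L, ∃ n₀, ∀ n ≥ n₀, Settled e L (initSeg α n) := by
    intro L
    choose N hN using he.complete
    refine ⟨(stringsUpTo (2 * L)).toFinset.sup N, fun n hn x hx => ?_⟩
    have hx' : N x ≤ n := (Finset.le_sup (f := N) (List.mem_toFinset.2 hx)).trans hn
    exact Option.isSome_iff_exists.2 ⟨_, he.mono hx' (hN x)⟩
  have hfreq : ∀ k, ∃ q ≥ k, m' ≤ q.unpair.1 ∧ HaltsAt q.unpair.1 q.unpair.2 ∧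
      Settled e q.unpair.1 (initSeg α q) := by
    intro k
    -- Weakness of α, applied to the predicate `Settled`: the oracle part needed for `L` has length
    -- `n` < `s` ≤ `Nat.pair L s`, so it is known when the round starts.
    obtain ⟨L, hL, s, hs, n, hn, hP⟩ := hweak (fun p => decide (Settled e p.1 p.2))
      (primrecRel_settled he.primrec).decide.to_comp (by simpa using hsettled) (max k m')
    refine ⟨Nat.pair L s, (le_max_left _ _).trans (hL.trans (Nat.left_le_pair L s)), ?_⟩
    simp only [Nat.unpair_pair]
    refine ⟨(le_max_right _ _).trans hL, hs, ?_⟩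
    exact hsettled_mono (hn.le.trans (Nat.right_le_pair L s)) (by simpa using hP)
  -- Each productive round adds at least C minus the value at γ, and no other round loses capital.
  have hunb : ∀ N : ℕ, ∃ q, N * ((C : ℝ) - value d γ) ≤ capital e γ C m' α (q * q) := by
    intro N
    induction N with
    | zero => exact ⟨0, by
        have := hge 0
        have h0 : 0 ≤ value d γ := by unfold value; positivity
        push_cast
        linarith⟩
    | succ N ih =>
      obtain ⟨k, hk⟩ := ih
      obtain ⟨q, hq, h1, h2, h3⟩ := hfreq k
      refine ⟨q + 1, ?_⟩
      have h4 := hgain q h1 h2 h3 (hge q)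
      have h5 := hmono' hq
      push_cast
      simp only at h5
      linarith
  obtain ⟨N, hN⟩ := exists_nat_gt (B / ((C : ℝ) - value d γ))
  obtain ⟨q, hq⟩ := hunb N
  rw [div_lt_iff₀ (by linarith)] at hN
  linarith [hBcap (q * q)]

/-! ### The second sequence -/

lemma Computes.mul_add {α : ℕ → Bool} {e e' : List Bool → List Bool → Option ℕ}
    {d d' : List Bool → ℕ} (h : Computes α e d) (h' : Computes α e' d') (K : ℕ) :
    Computes α (fun ρ x => (e ρ x).bind fun u => (e' ρ x).map fun v => K * u + v)
      (fun x => K * d x + d' x) where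
  primrec := Primrec.option_bind h.primrec
    (Primrec.option_map (h'.primrec.comp (Primrec.fst.comp .fst) (Primrec.snd.comp .fst))
      (Primrec.nat_add.comp (Primrec.nat_mul.comp (.const K) (Primrec.snd.comp .fst))
        .snd).to₂).to₂
  mono hmn hv := by
    simp only [Option.bind_eq_some_iff, Option.map_eq_some_iff] at hv ⊢
    obtain ⟨u, hu, w, hw, rfl⟩ := hv
    exact ⟨u, h.mono hmn hu, w, h'.mono hmn hw, rfl⟩
  sound hv := by
    simp only [Option.bind_eq_some_iff, Option.map_eq_some_iff] at hv
    obtain ⟨u, hu, w, hw, rfl⟩ := hv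
    rw [h.sound hu, h'.sound hw]
  complete x := by
    obtain ⟨m, hm⟩ := h.complete x
    obtain ⟨n, hn⟩ := h'.complete x
    refine ⟨max m n, ?_⟩
    rw [h.mono (le_max_left m n) hm, h'.mono (le_max_right m n) hn]
    rfl

lemma computes_zero (α : ℕ → Bool) : Computes α (fun _ _ => some 0) (fun _ => 0) where
  primrec := Primrec₂.const _
  mono _ h := h
  sound h := (Option.some.inj h).symm
  complete _ := ⟨0, rfl⟩

/-- With α fixed, the primitive recursive simulation `e` determines `d`, and there are only
countably many such `e`. -/
lemma countable_computes (α : ℕ → Bool) : {d | ∃ e, Computes α e d}.Countable := by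
  have : Countable {g : List Bool × List Bool → Option ℕ | Computable g} :=
    (countable_computable _ _).to_subtype
  have h : ∀ d : {d | ∃ e, Computes α e d}, ∃ e, Computes α e d.1 := fun d => d.2
  choose e he using h
  let F : {d | ∃ e, Computes α e d} → {g : List Bool × List Bool → Option ℕ | Computable g} :=
    fun d => ⟨fun p => e d p.1 p.2, (he d).primrec.to_comp⟩
  refine (Function.Injective.countable (f := F) fun d d' hdd => Subtype.ext ?_).to_set
  funext x
  obtain ⟨n, hn⟩ := (he d).complete x
  have h1 : e d (initSeg α n) x = e d' (initSeg α n) x :=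
    congrFun (congrArg Subtype.val hdd) (initSeg α n, x)
  exact (he d').sound (h1.symm.trans hn)

/-- There is a sequence `β` on which all `α`-computable supermartingales are bounded, and which
infinitely often contains a block copied from a position of `α` given by a late halting time. -/
theorem exists_random_with_blocks {α : ℕ → Bool}
    (hrand : ∀ d, Computable d → IsIntSupermartingale d → IntBoundedOn d α)
    (hweak : ∀ P : ℕ × List Bool → Bool, Computable P →
        (∀ L, ∃ n₀, ∀ n ≥ n₀, P (L, initSeg α n) = true) →
        ∀ m, ∃ L ≥ m, ∃ s, HaltsAt L s ∧ ∃ n < s, P (L, initSeg α n) = true) :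
    ∃ β : ℕ → Bool,
      (∀ e d, Computes α e d → IsIntSupermartingale d → IntBoundedOn d β) ∧
      ∀ m, ∃ L ≥ m, ∃ s, HaltsAt L s ∧
        ∀ i < L, β (L + i) = α (Nat.pair L s * Nat.pair L s + i) := by
  let D : Set (List Bool → ℕ) := {d | (∃ e, Computes α e d) ∧ IsIntSupermartingale d}
  let R : ℕ → List Bool → (List Bool → Prop) → Prop := fun m σ _ =>
    ∃ L ≥ m, ∃ s, HaltsAt L s ∧ ∃ u : List Bool, u.length = L ∧
      σ = u ++ block α (Nat.pair L s * Nat.pair L s) L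
  obtain ⟨β, h1, h2⟩ := exists_generic (D := D)
    ((countable_computes α).mono fun d hd => hd.1)
    ⟨fun _ => 0, ⟨_, computes_zero α⟩, fun _ => by simp⟩ (fun d hd => hd.2)
    (fun d ⟨⟨e, he⟩, hd⟩ d' ⟨⟨e', he'⟩, hd'⟩ K =>
      ⟨⟨_, he.mul_add he' K⟩, isIntSupermartingale_mul_add hd hd' K⟩)
    R (by
      rintro m d ⟨⟨e, he⟩, hd⟩ C γ hγ
      obtain ⟨L, hL, s, hs, u, hu, hγu, hsafe⟩ :=
        exists_extension_with_block hrand hweak he hd hγ m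
      exact ⟨_, hγu.trans (List.prefix_append _ _), hsafe, L, hL, s, hs, u, hu, rfl⟩)
  refine ⟨β, fun e d he hd => h1 d ⟨⟨e, he⟩, hd⟩, fun m => ?_⟩
  obtain ⟨n, -, ⟨L, hL, s, hs, u, hu, heq⟩, -⟩ := h2 m
  refine ⟨L, hL, s, hs, fun i hi => ?_⟩
  have hn : n = L + L := by simpa [hu] using congrArg List.length heq
  have h3 := congrArg (fun l : List Bool => l[L + i]?) heq
  simp only [getElem?_initSeg] at h3
  rw [if_pos (by omega), List.getElem?_append_right (by omega), hu, Nat.add_sub_cancel_left] at h3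
  simpa [block, hi] using h3

/-! ### A computable martingale that succeeds on the join -/

section bigOperators

variable {σ : Type*} [Primcodable σ] {n : σ → ℕ} {f : σ → ℕ → ℕ}

lemma primrec_sum_range (hn : Primrec n) (hf : Primrec₂ f) :
    Primrec fun a => ∑ k ∈ Finset.range (n a), f a k := by
  refine (Primrec.nat_rec' hn (.const 0) (h := fun a p => p.2 + f a p.1)
    (Primrec.nat_add.comp (Primrec.snd.comp .snd)
      (hf.comp .fst (Primrec.fst.comp .snd)))).of_eq fun a => ?_
  induction n a with
  | zero => rfl
  | succ k ih => rw [Finset.sum_range_succ, ← ih]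

lemma primrec_prod_range (hn : Primrec n) (hf : Primrec₂ f) :
    Primrec fun a => ∏ k ∈ Finset.range (n a), f a k := by
  refine (Primrec.nat_rec' hn (.const 1) (h := fun a p => p.2 * f a p.1)
    (Primrec.nat_mul.comp (Primrec.snd.comp .snd)
      (hf.comp .fst (Primrec.fst.comp .snd)))).of_eq fun a => ?_
  induction n a with
  | zero => rfl
  | succ k ih => rw [Finset.prod_range_succ, ← ih]

end bigOperators

/-- Position `k` of the first sequence belongs to the block of the program `L`. -/
def InBlock (L k : ℕ) : Prop :=
  k.sqrt.unpair.1 = L ∧ HaltsAt L k.sqrt.unpair.2 ∧ k < k.sqrt * k.sqrt + L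

instance : DecidableRel InBlock := fun _ _ => by unfold InBlock; infer_instance

/-- The position of the second sequence that predicts position `k` of the first one. -/
def source (L k : ℕ) : ℕ := L + (k - k.sqrt * k.sqrt)

/-- With q = sqrt k and k = q² + i, the source is L + i, and L < q ≤ q². The strict inequality needs
q > 0, which holds because the block for q = 0 is empty. -/
lemma InBlock.source_lt {L k : ℕ} (h : InBlock L k) : source L k < k := by
  obtain ⟨h1, -, h3⟩ := h
  have h4 := Nat.sqrt_le k
  have h5 := Nat.le_mul_self k.sqrt
  have h6 : L < k.sqrt := by
    rcases Nat.eq_zero_or_pos k.sqrt with h0 | h0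
    · rw [h0] at h1 h3 h4
      simp only [Nat.unpair_zero, Prod.fst_zero] at h1
      omega
    · exact h1 ▸ Nat.unpair_lt h0
  unfold source
  omega

lemma InBlock.lt {L k : ℕ} (h : InBlock L k) : L < k :=
  (Nat.le_add_right _ _).trans_lt h.source_lt

/-- The factor by which the bet on position `k` multiplies the capital reserved for `L`, on a
string that interleaves the two sequences. -/
def factor (L : ℕ) (z : List Bool) (k : ℕ) : ℕ :=
  if InBlock L k then
    if z.getD (2 * k) false = z.getD (2 * source L k + 1) false then 2 else 0
  else 1

/-- The capital reserved for the program `L`. -/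
def blockCapital (L : ℕ) (z : List Bool) : ℕ :=
  ∏ k ∈ Finset.range ((z.length + 1) / 2), factor L z k

/-- The total capital in units of `2 ^ (-|z|)`. -/
def totalCapital (z : List Bool) : ℕ :=
  1 + ∑ L ∈ Finset.range z.length, 2 ^ (z.length - 1 - L) * blockCapital L z

lemma factor_concat {L k : ℕ} {z : List Bool} (hk : 2 * k < z.length) (b : Bool) :
    factor L (z ++ [b]) k = factor L z k := by
  unfold factor
  by_cases h : InBlock L k
  · have := h.source_lt
    rw [List.getD_append _ _ _ _ hk, List.getD_append _ _ _ _ (by omega)]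
  · rw [if_neg h, if_neg h]

lemma factor_concat_add {L j : ℕ} {z : List Bool} (hz : z.length = 2 * j) :
    factor L (z ++ [false]) j + factor L (z ++ [true]) j = 2 := by
  unfold factor
  by_cases h : InBlock L j
  · have := h.source_lt
    have h1 : ∀ b : Bool, (z ++ [b]).getD (2 * j) false = b := by
      intro b
      rw [List.getD_append_right _ _ _ _ hz.le, hz, Nat.sub_self]
      rfl
    have h2 : ∀ b : Bool, (z ++ [b]).getD (2 * source L j + 1) false =
        z.getD (2 * source L j + 1) false :=
      fun b => List.getD_append _ _ _ _ (by omega)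
    simp only [h1, h2, if_pos h]
    cases z.getD (2 * source L j + 1) false <;> simp
  · simp [h]

lemma blockCapital_concat_add (L : ℕ) (z : List Bool) :
    blockCapital L (z ++ [false]) + blockCapital L (z ++ [true]) = 2 * blockCapital L z := by
  rcases Nat.even_or_odd' z.length with ⟨j, hj | hj⟩
  · have h1 : ∀ b, blockCapital L (z ++ [b]) = blockCapital L z * factor L (z ++ [b]) j := by
      intro b
      have h2 : ((z ++ [b]).length + 1) / 2 = j + 1 := by
        rw [List.length_append, List.length_singleton]; omega
      have h3 : (z.length + 1) / 2 = j := by omega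
      rw [blockCapital, h2, Finset.prod_range_succ, blockCapital, h3]
      congr 1
      refine Finset.prod_congr rfl fun k hk => factor_concat ?_ b
      have := Finset.mem_range.1 hk
      omega
    rw [h1, h1, ← mul_add, factor_concat_add hj, mul_comm]
  · have h1 : ∀ b, blockCapital L (z ++ [b]) = blockCapital L z := by
      intro b
      have h2 : ((z ++ [b]).length + 1) / 2 = (z.length + 1) / 2 := by
        rw [List.length_append, List.length_singleton]; omega
      rw [blockCapital, h2, blockCapital]
      refine Finset.prod_congr rfl fun k hk => factor_concat ?_ b
      have := Finset.mem_range.1 hk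
      omega
    rw [h1, h1, two_mul]

lemma blockCapital_of_length_le {L : ℕ} {z : List Bool} (h : z.length ≤ L) :
    blockCapital L z = 1 := by
  refine Finset.prod_eq_one fun k hk => if_neg fun hb => ?_
  have := hb.lt
  have := Finset.mem_range.1 hk
  omega

/-- Each L owns the initial capital 2^(-L-1). Those with L ≥ |z| have not bet yet and together own
2^(-|z|), the summand 1 in `totalCapital`; when the string grows, this summand splits into the share
of L = |z| and the new remainder, so the finite sum is exactly fair. -/
lemma totalCapital_concat_add (z : List Bool) :
    totalCapital (z ++ [false]) + totalCapital (z ++ [true]) = 4 * totalCapital z := by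
  have h : ∀ L ∈ Finset.range z.length,
      2 ^ (z.length - L) * (2 * blockCapital L z) =
        4 * (2 ^ (z.length - 1 - L) * blockCapital L z) := by
    intro L hL
    have hL := Finset.mem_range.1 hL
    obtain ⟨i, hi⟩ : ∃ i, z.length - L = i + 1 := ⟨z.length - L - 1, by omega⟩
    rw [hi, show z.length - 1 - L = i by omega, pow_succ]
    ring
  have h2 : ∀ b, totalCapital (z ++ [b]) =
      1 + ∑ L ∈ Finset.range (z.length + 1), 2 ^ (z.length - L) * blockCapital L (z ++ [b]) := by
    intro b
    simp [totalCapital]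
  have h3 : totalCapital (z ++ [false]) + totalCapital (z ++ [true]) = 2 +
      ∑ L ∈ Finset.range (z.length + 1), 2 ^ (z.length - L) * (2 * blockCapital L z) := by
    simp only [h2, ← blockCapital_concat_add, mul_add, Finset.sum_add_distrib]
    omega
  rw [h3, Finset.sum_range_succ, Finset.sum_congr rfl h, ← Finset.mul_sum,
    blockCapital_of_length_le le_rfl, totalCapital, Nat.sub_self]
  ring

lemma primrec_blockCapital : Primrec₂ blockCapital := by
  have hL : Primrec fun p : (ℕ × List Bool) × ℕ => p.1.1 := Primrec.fst.comp .fst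
  have hz : Primrec fun p : (ℕ × List Bool) × ℕ => p.1.2 := Primrec.snd.comp .fst
  have hk : Primrec fun p : (ℕ × List Bool) × ℕ => p.2 := .snd
  have hq := Primrec.nat_sqrt.comp hk
  have hu := Primrec.unpair.comp hq
  have hsource : Primrec fun p : (ℕ × List Bool) × ℕ => source p.1.1 p.2 :=
    Primrec.nat_add.comp hL (Primrec.nat_sub.comp hk (Primrec.nat_mul.comp hq hq))
  have hin : PrimrecPred fun p : (ℕ × List Bool) × ℕ => InBlock p.1.1 p.2 :=
    (Primrec.eq.comp (Primrec.fst.comp hu) hL).and <|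
      (Primrec.primrecPred (primrec_haltsAt.comp (hL.pair (Primrec.snd.comp hu)))).and <|
        Primrec.nat_lt.comp hk (Primrec.nat_add.comp (Primrec.nat_mul.comp hq hq) hL)
  have hget := fun {f : (ℕ × List Bool) × ℕ → ℕ} (hf : Primrec f) =>
    (Primrec.list_getD false).comp hz hf
  refine primrec_prod_range (Primrec.nat_div.comp
    (Primrec.succ.comp (Primrec.list_length.comp .snd)) (.const 2)) ?_
  exact Primrec.ite hin (Primrec.ite (Primrec.eq.comp
    (hget (Primrec.nat_mul.comp (.const 2) hk))
    (hget (Primrec.succ.comp (Primrec.nat_mul.comp (.const 2) hsource))))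
    (.const 2) (.const 0)) (.const 1)

lemma primrec_totalCapital : Primrec totalCapital := by
  have hlen : Primrec fun p : List Bool × ℕ => p.1.length := Primrec.list_length.comp .fst
  refine Primrec.nat_add.comp (.const 1) (primrec_sum_range .list_length ?_)
  exact Primrec.nat_mul.comp
    (primrec_pow.comp (.const 2) (Primrec.nat_sub.comp
      (Primrec.nat_sub.comp hlen (.const 1)) .snd))
    (primrec_blockCapital.comp .snd .fst)

/-- The martingale that uses the second sequence to predict the first one. -/
noncomputable def predictor (z : List Bool) : ℝ≥0 := totalCapital z / 2 ^ z.length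

lemma isMartingale_predictor : IsMartingale predictor := by
  intro z
  have h : (totalCapital (z ++ [false]) + totalCapital (z ++ [true]) : ℝ≥0) =
      4 * totalCapital z := by exact_mod_cast totalCapital_concat_add z
  simp only [predictor, List.length_append, List.length_singleton]
  rw [← add_div, h, pow_succ]
  field_simp
  norm_num

lemma realComputable_predictor : RealComputable predictor := by
  refine ⟨fun z n => totalCapital z * 2 ^ n / 2 ^ z.length, ?_, fun z n => ?_⟩
  · exact (Primrec.nat_div.comp (Primrec.nat_mul.comp (primrec_totalCapital.comp .fst)
      (primrec_pow.comp (.const 2) .snd))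
      (primrec_pow.comp (.const 2) (Primrec.list_length.comp .fst))).to_comp
  · have hpos : (0 : ℝ) < 2 ^ z.length := by positivity
    have hn : (0 : ℝ) < 2 ^ n := by positivity
    set t := totalCapital z * 2 ^ n / 2 ^ z.length with ht
    have h1 : t * 2 ^ z.length ≤ totalCapital z * 2 ^ n := Nat.div_mul_le_self _ _
    have h2 : totalCapital z * 2 ^ n < (t + 1) * 2 ^ z.length := by
      rw [mul_comm (t + 1)]
      exact Nat.lt_mul_div_succ _ (by positivity)
    have h1' : (t * 2 ^ z.length : ℝ) ≤ totalCapital z * 2 ^ n := by exact_mod_cast h1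
    have h2' : (totalCapital z * 2 ^ n : ℝ) < (t + 1) * 2 ^ z.length := by exact_mod_cast h2
    have h3 : ((predictor z : ℝ≥0) : ℝ) = totalCapital z / 2 ^ z.length := by
      simp [predictor]
    have h4 : (t : ℝ) / 2 ^ n ≤ totalCapital z / 2 ^ z.length := by
      rwa [div_le_div_iff₀ hn hpos]
    have h5 : (totalCapital z / 2 ^ z.length : ℝ) ≤ t / 2 ^ n + 1 / 2 ^ n := by
      rw [← add_div, div_le_div_iff₀ hpos hn]
      exact h2'.le
    have h6 : (0 : ℝ) < 1 / 2 ^ n := by positivity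
    change |((predictor z : ℝ≥0) : ℝ) - (t : ℝ) / 2 ^ n| ≤ 1 / 2 ^ n
    rw [h3, abs_le]
    constructor <;> linarith

lemma join_two_mul (α β : ℕ → Bool) (k : ℕ) : join α β (2 * k) = α k := by simp [join]

lemma join_two_mul_add_one (α β : ℕ → Bool) (k : ℕ) : join α β (2 * k + 1) = β k := by
  have h2 : (2 * k + 1) / 2 = k := by omega
  simp [join, h2]

lemma two_pow_le_blockCapital {α β : ℕ → Bool} {L s : ℕ} (hs : HaltsAt L s)
    (h : ∀ i < L, β (L + i) = α (Nat.pair L s * Nat.pair L s + i)) {n : ℕ}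
    (hn : 2 * (Nat.pair L s * Nat.pair L s + L) ≤ n) :
    blockCapital L (initSeg (join α β) n) = 2 ^ L := by
  set q := Nat.pair L s with hq
  have hLq : L ≤ q := Nat.left_le_pair L s
  have hget : ∀ k < n, (initSeg (join α β) n).getD k false = join α β k := by
    intro k hk
    rw [List.getD_eq_getElem?_getD, getElem?_initSeg, if_pos hk, Option.getD_some]
  have hf : ∀ k ∈ Finset.range (((initSeg (join α β) n).length + 1) / 2),
      factor L (initSeg (join α β) n) k =
        if k ∈ Finset.Ico (q * q) (q * q + L) then 2 else 1 := by
    intro k hk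
    rw [Finset.mem_range, length_initSeg] at hk
    have hiff : InBlock L k ↔ k ∈ Finset.Ico (q * q) (q * q + L) := by
      rw [Finset.mem_Ico]
      constructor
      · rintro ⟨h1, h2, h3⟩
        have : k.sqrt = q := by rw [hq, ← hs.unique h2 |>.symm, ← h1, Nat.pair_unpair]
        rw [this] at h3
        exact ⟨this ▸ Nat.sqrt_le k, h3⟩
      · rintro ⟨h1, h2⟩
        obtain ⟨i, rfl⟩ := Nat.exists_eq_add_of_le h1
        have h3 : (q * q + i).sqrt = q := Nat.sqrt_add_eq q (by omega)
        simp only [InBlock, h3]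
        rw [hq, Nat.unpair_pair]
        exact ⟨rfl, hs, h2⟩
    unfold factor
    by_cases hb : InBlock L k
    · have hlt := hb.source_lt
      rw [if_pos hb, if_pos (hiff.1 hb), if_pos]
      rw [hget _ (by omega), hget _ (by omega), join_two_mul, join_two_mul_add_one]
      obtain ⟨h1, h2⟩ := Finset.mem_Ico.1 (hiff.1 hb)
      obtain ⟨i, rfl⟩ := Nat.exists_eq_add_of_le h1
      have h3 : (q * q + i).sqrt = q := Nat.sqrt_add_eq q (by omega)
      rw [source, h3, Nat.add_sub_cancel_left, h i (by omega)]
    · rw [if_neg hb, if_neg (mt hiff.2 hb)]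
  rw [blockCapital, Finset.prod_congr rfl hf, Finset.prod_ite_mem, Finset.inter_eq_right.2,
    Finset.prod_const, Nat.card_Ico, Nat.add_sub_cancel_left]
  intro k hk
  rw [Finset.mem_Ico] at hk
  rw [Finset.mem_range, length_initSeg]
  omega

/-- If `β` contains infinitely many blocks copied from `α`, then `α ⊕ β` is not computably
random. -/
theorem not_CR_join {α β : ℕ → Bool}
    (h : ∀ m, ∃ L ≥ m, ∃ s, HaltsAt L s ∧
      ∀ i < L, β (L + i) = α (Nat.pair L s * Nat.pair L s + i)) : ¬ CR (join α β) := by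
  intro hCR
  obtain ⟨B, hB⟩ := hCR predictor isMartingale_predictor realComputable_predictor
  let S : Set ℕ := {L | ∃ s, HaltsAt L s ∧
    ∀ i < L, β (L + i) = α (Nat.pair L s * Nat.pair L s + i)}
  have hS : S.Infinite := Set.infinite_of_forall_exists_gt fun m =>
    let ⟨L, hL, hs⟩ := h (m + 1)
    ⟨L, hs, hL⟩
  -- Each successful program contributes 1/2, so more than 2B of them exceed the bound B.
  obtain ⟨N, hN⟩ := exists_nat_gt (2 * B)
  obtain ⟨T, hTS, hT⟩ := hS.exists_subset_card_eq N
  choose! s hs using fun L (hL : L ∈ S) => hL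
  -- Long enough for every chosen L to occur in the sum and for its whole block in α to have been
  -- read.
  let n := T.sup (fun L => 2 * (Nat.pair L (s L) * Nat.pair L (s L) + L) + L + 1) + 1
  have hn : ∀ L ∈ T, 2 * (Nat.pair L (s L) * Nat.pair L (s L) + L) + L + 1 < n := fun L hL =>
    Nat.lt_succ_of_le
      (Finset.le_sup (f := fun L => 2 * (Nat.pair L (s L) * Nat.pair L (s L) + L) + L + 1) hL)
  have h1 : N * 2 ^ (n - 1) ≤ totalCapital (initSeg (join α β) n) := by
    rw [totalCapital, length_initSeg]
    refine le_trans ?_ (Nat.le_add_left _ _)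
    calc N * 2 ^ (n - 1) = ∑ L ∈ T, 2 ^ (n - 1) := by rw [Finset.sum_const, hT, smul_eq_mul]
      _ = ∑ L ∈ T, 2 ^ (n - 1 - L) * blockCapital L (initSeg (join α β) n) := by
        refine Finset.sum_congr rfl fun L hL => ?_
        have h2 := hn L hL
        obtain ⟨h3, h4⟩ := hs L (hTS hL)
        rw [two_pow_le_blockCapital h3 h4 (by omega), ← pow_add, Nat.sub_add_cancel (by omega)]
      _ ≤ _ := by
        refine Finset.sum_le_sum_of_subset fun L hL => Finset.mem_range.2 ?_
        have := hn L hL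
        omega
  have h2 : predictor (initSeg (join α β) n) ≤ B := hB ⟨n, rfl⟩
  rw [predictor, length_initSeg, div_le_iff₀ (by positivity)] at h2
  have h3 : (N * 2 ^ (n - 1) : ℝ≥0) ≤ B * 2 ^ n := le_trans (by exact_mod_cast h1) h2
  have h4 : (2 : ℝ≥0) ^ n = 2 * 2 ^ (n - 1) := by
    rw [← pow_succ', Nat.sub_add_cancel (by omega)]
  rw [h4, ← mul_assoc, mul_comm B] at h3
  exact absurd (le_of_mul_le_mul_right h3 (by positivity)) (not_le.2 hN)

/-! ### Uniform computability and conclusion -/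

lemma recursiveIn_eval (O : ℕ →. ℕ) (c : OracleCode) : Nat.RecursiveIn {O} (c.eval O) := by
  induction c with
  | zero => exact .zero
  | succ => exact .succ
  | left => exact .left
  | right => exact .right
  | oracle => exact .oracle O rfl
  | pair c d hc hd => exact .pair hc hd
  | comp c d hc hd => exact .comp hc hd
  | prec c d hc hd => exact .prec hc hd
  | rfind c hc => exact .rfind hc

lemma RealComputableUnif.realComputableRel {α : ℕ → Bool} {f : List Bool → ℝ≥0}
    (h : RealComputableUnif α f) : RealComputableRel α f := by
  obtain ⟨c, -, a, ha, happ⟩ := h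
  refine ⟨a, ?_, happ⟩
  have hdec := Nat.Partrec.recursiveIn (O := {bitOracle α})
    (Computable.encode (α := List Bool × ℕ)).partrec
  refine Nat.RecursiveIn.of_eq (.comp (recursiveIn_eval _ c) hdec) fun n => ?_
  rcases hn : Encodable.decode (α := List Bool × ℕ) n with _ | ⟨x, k⟩
  · simp only [Part.coe_none, Part.bind_none]
    exact Part.bind_none _
  · simp only [Part.coe_some, Part.bind_some, PFun.coe_val, Part.map_some]
    exact (Part.bind_some _ _).trans (ha x k)

lemma CRRel.crUnif {α β : ℕ → Bool} (h : CRRel α β) : CRUnif α β :=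
  fun f hf hc => h f hf hc.realComputableRel

/-- Van Lambalgen's theorem fails for computable randomness. -/
theorem exists_CR_CRRel_not_CR_join :
    ∃ α β : ℕ → Bool, CR α ∧ CRRel α β ∧ ¬ CR (join α β) := by
  obtain ⟨α, hrand, hweak⟩ := exists_random_of_weak_oracle
  obtain ⟨β, hβ, hblock⟩ := exists_random_with_blocks hrand hweak
  refine ⟨α, β, ?_, ?_, not_CR_join hblock⟩
  · rintro f hf ⟨a, ha, happ⟩
    exact happ.boundedOn (hrand _ (computable_roundUp ha) (happ.isIntSupermartingale hf))
  · rintro f hf ⟨a, ha, happ⟩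
    obtain ⟨e, he⟩ := exists_computes_roundUp ha
    exact happ.boundedOn (hβ e _ he (happ.isIntSupermartingale hf))

end VanLambalgen

theorem theorem1 :
    (∃ ω : ℕ → Bool,
      ¬ VanLambalgen.CR ω ∧
      VanLambalgen.CR (VanLambalgen.oddBits ω) ∧
      VanLambalgen.CRRel (VanLambalgen.oddBits ω) (VanLambalgen.evenBits ω)) ∧
    (¬ ∀ α β : ℕ → Bool, VanLambalgen.CR α → VanLambalgen.CRRel α β →
      VanLambalgen.CR (VanLambalgen.join α β)) ∧
    (¬ ∀ α β : ℕ → Bool, VanLambalgen.CR α → VanLambalgen.CRUnif α β →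
      VanLambalgen.CR (VanLambalgen.join α β)) := by
  obtain ⟨α, β, hα, hβ, hjoin⟩ := VanLambalgen.exists_CR_CRRel_not_CR_join
  have hodd : VanLambalgen.oddBits (VanLambalgen.join α β) = α :=
    funext fun k => VanLambalgen.join_two_mul α β k
  have heven : VanLambalgen.evenBits (VanLambalgen.join α β) = β :=
    funext fun k => VanLambalgen.join_two_mul_add_one α β k
  refine ⟨⟨VanLambalgen.join α β, hjoin, ?_, ?_⟩, fun h => hjoin (h α β hα hβ),
    fun h => hjoin (h α β hα hβ.crUnif)⟩
  · rwa [hodd]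
  · rwa [hodd, heven]
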